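/- Let $I=(-1,1)$, $\omega(x)=\sqrt{1-x^2}$, and let $V=H^1_{0,\omega}(I)=\{u\in L^2(I): \int_I\omega|u'|^2\,dx<\infty,\ u(\pm1)=0\}$ (weak derivative; functions in this space are continuous on $[-1,1]$ up to a null set, which gives meaning to the boundary values). Put $\|u\|_V=\bigl(\int_I\omega|u'|^2\,dx\bigr)^{1/2}$, $\|u\|_{L^2}=\bigl(\int_I|u|^2\,dx\bigr)^{1/2}$, and let $\|u\|_m=\bigl(\sum_{k=0}^m\|u^{(k)}\|_{L^2}^2\bigr)^{1/2}$ be the norm of the Sobolev space $H^m(I)$. Let $T_n$ be the Chebyshev polynomials of the first kind, $\varphi_n=T_{n+2}-T_n$, and $V_N=\operatorname{span}\{\varphi_0,\dots,\varphi_{N-2}\}$ (with $V_1=\{0\}$). Let $f$ be a real function on $I$ such that $fv$ is integrable on $I$ for all $v\in V$ (for example $f\in L^2(I)$ or $f\in L^1(I)$). Let $u\in V$ be the weak solution of $-(\omega u')'=f$ in $I$, $u(\pm1)=0$, that is, $$\int_I\omega u'v'\,dx=\int_I fv\,dx\qquad\text{for all } v\in V,$$ and let $u_N\in V_N$ be a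 solution of the discrete problem $$-\int_I(\omega u_N')'\,\varphi_k\,dx=\int_I f\varphi_k\,dx,\qquad k=0,\dots,N-2.$$ Theorem. For every integer $m\ge2$ there is a constant $C>0$, depending only on $m$, such that for all $f$, $u$ as above with $u\in H^m(I)$, all integers $N\ge1$ and all $u_N$ as above, $$\|u-u_N\|_V\le C N^{1-m}\|u\|_m\qquad\text{and}\qquad \|u-u_N\|_{L^2}\le C N^{-m}\|u\|_m .$$ -/

import Mathlib

open MeasureTheory Polynomial
open scoped ContDiff

namespace ChebyshevDegenerate

noncomputable section

/-- The interval `I = (-1, 1)`. -/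
def dom : Set ℝ := Set.Ioo (-1) 1

/-- The degenerate weight `ω(x) = √(1 - x²)`. -/
def weight (x : ℝ) : ℝ := Real.sqrt (1 - x ^ 2)

/-- `g` is a `k`-th weak derivative of `u` on `I`:
`∫_I u φ⁽ᵏ⁾ = (-1)ᵏ ∫_I g φ` for all `φ ∈ C_c^∞(I)`. -/
def HasWeakDeriv (k : ℕ) (u g : ℝ → ℝ) : Prop :=
  LocallyIntegrableOn u dom ∧ LocallyIntegrableOn g dom ∧
    ∀ φ : ℝ → ℝ, ContDiff ℝ ∞ φ → HasCompactSupport φ → tsupport φ ⊆ dom →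
      ∫ x in dom, u x * iteratedDeriv k φ x = (-1) ^ k * ∫ x in dom, g x * φ x

/-- Weak derivatives are unique up to a null set. -/
theorem HasWeakDeriv.ae_eq {k : ℕ} {u g h : ℝ → ℝ}
    (hg : HasWeakDeriv k u g) (hh : HasWeakDeriv k u h) :
    g =ᵐ[volume.restrict dom] h := by
  obtain ⟨-, hgl, hg⟩ := hg
  obtain ⟨-, hhl, hh⟩ := hh
  have hmul : ∀ w φ : ℝ → ℝ, LocallyIntegrableOn w dom → ContDiff ℝ ∞ φ →
      HasCompactSupport φ → tsupport φ ⊆ dom →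
      IntegrableOn (fun x => φ x * w x) dom := by
    intro w φ hw hφ hc hs
    have h1 : IntegrableOn (fun x => φ x * w x) (tsupport φ) :=
      (hw.integrableOn_compact_subset hs hc).continuousOn_mul hφ.continuous.continuousOn hc
    refine IntegrableOn.of_forall_sdiff_eq_zero h1 measurableSet_Ioo ?_
    intro x hx
    simp [image_eq_zero_of_notMem_tsupport hx.2]
  have key : ∀ᵐ x ∂volume, x ∈ dom → g x - h x = 0 := by
    refine isOpen_Ioo.ae_eq_zero_of_integral_contDiff_smul_eq_zero (hgl.sub hhl) ?_
    intro φ hφ hc hs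
    have e := (hg φ hφ hc hs).symm.trans (hh φ hφ hc hs)
    have e' : ∫ x in dom, φ x * g x = ∫ x in dom, φ x * h x := by
      simpa [mul_comm] using e
    have hz : ∫ x, φ x • (g x - h x) = ∫ x in dom, φ x • (g x - h x) := by
      refine (setIntegral_eq_integral_of_forall_compl_eq_zero ?_).symm
      intro x hx
      simp [image_eq_zero_of_notMem_tsupport (fun h => hx (hs h))]
    have hsub : ∫ x in dom, φ x • (g x - h x)
        = (∫ x in dom, φ x * g x) - ∫ x in dom, φ x * h x := by
      rw [← integral_sub (hmul g φ hgl hφ hc hs) (hmul h φ hhl hφ hc hs)]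
      simp [mul_sub]
    simpa [e'] using hz.trans hsub
  refine (ae_restrict_iff' measurableSet_Ioo).2 ?_
  filter_upwards [key] with x hx hxd
  exact sub_eq_zero.1 (hx hxd)

open Classical in
/-- The `k`-th weak derivative of `u` on `I` (a representative, unique up to a null set;
zero if there is none). -/
def weakDeriv (k : ℕ) (u : ℝ → ℝ) : ℝ → ℝ :=
  if h : ∃ g, HasWeakDeriv k u g then h.choose else 0

/-- `u ∈ H^m(I)`: all weak derivatives of order at most `m` exist and lie in `L²(I)`. -/
def MemH (m : ℕ) (u : ℝ → ℝ) : Prop :=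
  ∀ k ≤ m, ∃ g, HasWeakDeriv k u g ∧ MemLp g 2 (volume.restrict dom)

/-- The norm `‖u‖_m` of `H^m(I)`. -/
def normH (m : ℕ) (u : ℝ → ℝ) : ℝ :=
  Real.sqrt (∑ k ∈ Finset.range (m + 1), ∫ x in dom, (weakDeriv k u x) ^ 2)

/-- `u = 0` on `∂I`: the continuous representative of `u` on `[-1, 1]` vanishes at `±1`. -/
def ZeroTrace (u : ℝ → ℝ) : Prop :=
  ∃ w : ℝ → ℝ, ContinuousOn w (Set.Icc (-1) 1) ∧ u =ᵐ[volume.restrict dom] w ∧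
    w (-1) = 0 ∧ w 1 = 0

/-- `u ∈ V = H¹_{0,ω}(I)`: `u ∈ L²(I)`, `∫_I ω |u'|² < ∞` and `u = 0` on `∂I`. -/
def MemV (u : ℝ → ℝ) : Prop :=
  MemLp u 2 (volume.restrict dom) ∧
    (∃ g, HasWeakDeriv 1 u g ∧ IntegrableOn (fun x => weight x * g x ^ 2) dom) ∧
    ZeroTrace u

/-- The bilinear form `a(u, v) = ∫_I ω u' v'`. -/
def energyForm (u v : ℝ → ℝ) : ℝ :=
  ∫ x in dom, weight x * weakDeriv 1 u x * weakDeriv 1 v x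

/-- The energy norm `‖u‖_V = (∫_I ω |u'|²)^{1/2}`. -/
def normV (u : ℝ → ℝ) : ℝ :=
  Real.sqrt (∫ x in dom, weight x * (weakDeriv 1 u x) ^ 2)

/-- The norm `‖u‖_U` of `U = L²(I)`. -/
def normU (u : ℝ → ℝ) : ℝ :=
  Real.sqrt (∫ x in dom, (u x) ^ 2)

/-- `u` is the weak solution of `-(ω u')' = f` in `I`, `u = 0` on `∂I`: `u ∈ V` and
`a(u, v) = (f, v)` for all `v ∈ V`. The datum `f` is any function for which all the
pairings `(f, v)` make sense; this contains `L²(I)` and `L¹(I)`. -/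
def IsWeakSolution (f u : ℝ → ℝ) : Prop :=
  MemV u ∧ ∀ v, MemV v →
    IntegrableOn (fun x => f x * v x) dom ∧ energyForm u v = ∫ x in dom, f x * v x

/-- The basis functions `φ_n = T_{n+2} - T_n`. -/
def phi (n : ℕ) : ℝ[X] := Chebyshev.T ℝ (n + 2) - Chebyshev.T ℝ n

/-- The trial space `V_N = span {φ_0, …, φ_{N-2}}`. -/
def trialSpace (N : ℕ) : Submodule ℝ ℝ[X] :=
  Submodule.span ℝ {p | ∃ n : ℕ, n + 2 ≤ N ∧ p = phi n}

/-- `uN ∈ V_N` solves the discrete problem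
`∫_I -(ω uN')' φ_k = ∫_I f φ_k` for `k = 0, …, N - 2`. -/
def IsDiscreteSolution (f : ℝ → ℝ) (N : ℕ) (uN : ℝ[X]) : Prop :=
  uN ∈ trialSpace N ∧ ∀ k : ℕ, k + 2 ≤ N →
    ∫ x in dom, -(deriv (fun y => weight y * uN.derivative.eval y) x) * (phi k).eval x
      = ∫ x in dom, f x * (phi k).eval x

end

end ChebyshevDegenerate

open ChebyshevDegenerate

namespace ChebyshevDegenerate

/-! Everything is read off from the expansion of the error derivative `d = u' - u_N'` in the
Chebyshev polynomials `U_k`, which are orthogonal for the weight `ω`.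

Since `φ_n' = (n+2) U_{n+1} - n U_{n-1}`, Galerkin orthogonality is a two-term recurrence for the
coefficients `d_k` with `k < N`: the odd ones vanish and the even ones are `l / (k+1)` with `l =
d_0` (`coef_eq_of_orthogonal`). For `k ≥ N` the polynomial `u_N'` contributes nothing, so `d_k` is a
coefficient of `u'`. Thus only the scalar `l` is unknown. It is fixed by `∫ d = 0`, which follows
from the boundary conditions: as `∫ U_k = (1 + (-1)^k) / (k+1)`, the low part contributes `l` times
a sum bounded below, so `|l|` is controlled by the tail of the endpoint series (`abs_lead_le`).

Smoothness enters through `coef_succ_eq`: a coefficient of an antiderivative is a difference of two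
coefficients of the function, each divided by its index. Bessel's inequality for `u^(m)` and
iteration (`sum_sq_chain`) bound the square root of the tail sum of squares of the coefficients of
`u'` by a multiple of `N^(1-m)`, giving the energy estimate. The same argument for `u''`, followed
by summation by parts in the endpoint series (`abs_sum_tail_le`), gives `|l| = O(N^(-m))`;
Cauchy-Schwarz alone would lose half a power of `N`.

For the `L²` estimate no duality argument is used. The error is the primitive of `d`, that is, the
series of `d_k T_{k+1} / (k+1)` minus its value at `-1`: the division by `k+1` gains the missing
power in the high part, and the low part and the endpoint value are controlled by `|l|` and the
endpoint tails (`integral_sq_prim_le_of_coef`).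

This works for `N ≥ 2m`. The finitely many smaller `N` are covered by the stability of the Galerkin
projection (`wip_self_le_of_orthogonal`). -/

/-! ### Primitives and weak derivatives on the interval. -/

theorem integrableOn_dom_iff {g : ℝ → ℝ} :
    IntegrableOn g dom ↔ IntervalIntegrable g volume (-1) 1 :=
  (intervalIntegrable_iff_integrableOn_Ioo_of_le (by norm_num)).symm

theorem integral_dom (g : ℝ → ℝ) : ∫ x in dom, g x = ∫ x in (-1 : ℝ)..1, g x := by
  rw [intervalIntegral.integral_of_le (by norm_num), integral_Ioc_eq_integral_Ioo]; rfl

instance isFiniteMeasure_restrict_dom : IsFiniteMeasure (volume.restrict dom) :=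
  ⟨by simp [dom]⟩

/-- The primitive of `g` on `[-1, 1]` that vanishes at `-1`. -/
noncomputable def prim (g : ℝ → ℝ) (x : ℝ) : ℝ := ∫ t in (-1 : ℝ)..x, g t

@[simp] theorem prim_neg_one (g : ℝ → ℝ) : prim g (-1) = 0 := by simp [prim]

theorem prim_one (g : ℝ → ℝ) : prim g 1 = ∫ x in dom, g x := (integral_dom g).symm

theorem absolutelyContinuousOnInterval_prim {g : ℝ → ℝ} (hg : IntegrableOn g dom) :
    AbsolutelyContinuousOnInterval (prim g) (-1) 1 :=
  (integrableOn_dom_iff.1 hg).absolutelyContinuousOnInterval_intervalIntegral (by simp)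

theorem continuousOn_prim {g : ℝ → ℝ} (hg : IntegrableOn g dom) :
    ContinuousOn (prim g) (Set.Icc (-1) 1) := by
  simpa [Set.uIcc_of_le] using (absolutelyContinuousOnInterval_prim hg).continuousOn

theorem deriv_prim_ae {g : ℝ → ℝ} (hg : IntegrableOn g dom) :
    ∀ᵐ x, x ∈ Set.uIcc (-1 : ℝ) 1 → deriv (prim g) x = g x := by
  filter_upwards [(integrableOn_dom_iff.1 hg).ae_hasDerivAt_integral] with x hx hxm
  exact (hx hxm (-1) (by simp)).deriv

/-- Integration by parts for primitives of integrable functions. -/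
theorem integral_prim_mul {f g : ℝ → ℝ} (hg : IntegrableOn g dom) (hf : IntegrableOn f dom) :
    ∫ x in dom, prim g x * f x = prim g 1 * prim f 1 - ∫ x in dom, g x * prim f x := by
  have h := (absolutelyContinuousOnInterval_prim hg).integral_mul_deriv_eq_deriv_mul
    (absolutelyContinuousOnInterval_prim hf)
  have h1 : ∫ x in (-1 : ℝ)..1, prim g x * deriv (prim f) x
      = ∫ x in (-1 : ℝ)..1, prim g x * f x := by
    refine intervalIntegral.integral_congr_ae ?_
    filter_upwards [deriv_prim_ae hf] with x hx hxm
    rw [hx (Set.uIoc_subset_uIcc hxm)]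
  have h2 : ∫ x in (-1 : ℝ)..1, deriv (prim g) x * prim f x
      = ∫ x in (-1 : ℝ)..1, g x * prim f x := by
    refine intervalIntegral.integral_congr_ae ?_
    filter_upwards [deriv_prim_ae hg] with x hx hxm
    rw [hx (Set.uIoc_subset_uIcc hxm)]
  rw [integral_dom, integral_dom, ← h1, ← h2, h]
  simp

/-- A function that is continuous on `[-1, 1]` and differentiable inside with integrable
derivative is a primitive. -/
theorem eq_prim_of_hasDerivAt {F F' : ℝ → ℝ} (hF : ContinuousOn F (Set.Icc (-1) 1))
    (hd : ∀ x ∈ dom, HasDerivAt F (F' x) x) (hi : IntegrableOn F' dom) {x : ℝ}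
    (hx : x ∈ Set.Icc (-1 : ℝ) 1) : F x = F (-1) + prim F' x := by
  have h : ∫ t in (-1 : ℝ)..x, F' t = F x - F (-1) := by
    refine intervalIntegral.integral_eq_sub_of_hasDerivAt_of_le hx.1
      (hF.mono (Set.Icc_subset_Icc_right hx.2)) (fun t ht => hd t ⟨ht.1, ht.2.trans_le hx.2⟩) ?_
    refine (integrableOn_dom_iff.1 hi).mono_set ?_
    rw [Set.uIcc_of_le hx.1, Set.uIcc_of_le (by norm_num)]
    exact Set.Icc_subset_Icc_right hx.2
  rw [prim, h]; ring

theorem integrableOn_mul_test {w φ : ℝ → ℝ} (hw : LocallyIntegrableOn w dom) (hφ : Continuous φ)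
    (hc : HasCompactSupport φ) (hs : tsupport φ ⊆ dom) :
    IntegrableOn (fun x => w x * φ x) dom := by
  have h1 : IntegrableOn (fun x => w x * φ x) (tsupport φ) :=
    (hw.integrableOn_compact_subset hs hc).mul_continuousOn hφ.continuousOn hc
  refine IntegrableOn.of_forall_sdiff_eq_zero h1 measurableSet_Ioo ?_
  intro x hx
  simp [image_eq_zero_of_notMem_tsupport hx.2]

theorem exists_Icc_of_isCompact_subset_dom {K : Set ℝ} (hK : IsCompact K) (hs : K ⊆ dom) :
    ∃ r, 0 ≤ r ∧ r < 1 ∧ K ⊆ Set.Icc (-r) r := by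
  obtain ⟨x, hx, hmax⟩ := (hK.insert 0).exists_isMaxOn ⟨0, by simp⟩
    (continuous_abs.continuousOn (s := insert (0 : ℝ) K))
  refine ⟨|x|, abs_nonneg _, ?_, fun y hy => abs_le.1 (hmax (Set.mem_insert_of_mem _ hy))⟩
  rcases hx with rfl | hx
  · simp
  · exact abs_lt.2 (hs hx)

theorem test_eq_zero {φ : ℝ → ℝ} (hs : tsupport φ ⊆ dom) {x : ℝ} (hx : x ∉ dom) : φ x = 0 :=
  image_eq_zero_of_notMem_tsupport fun h => hx (hs h)

/-- A test function with vanishing integral is the derivative of a test function. -/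
theorem exists_test_primitive {η : ℝ → ℝ} (hη : ContDiff ℝ ∞ η) (hc : HasCompactSupport η)
    (hs : tsupport η ⊆ dom) (h0 : ∫ x, η x = 0) :
    ∃ χ : ℝ → ℝ, ContDiff ℝ ∞ χ ∧ HasCompactSupport χ ∧ tsupport χ ⊆ dom ∧ deriv χ = η := by
  obtain ⟨r, hr0, hr1, hr⟩ := exists_Icc_of_isCompact_subset_dom hc hs
  have hd : ∀ x, HasDerivAt (prim η) (η x) x := fun x =>
    intervalIntegral.integral_hasDerivAt_right (hη.continuous.intervalIntegrable _ _)
      hη.continuous.stronglyMeasurable.stronglyMeasurableAtFilter hη.continuous.continuousAt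
  have hderiv : deriv (prim η) = η := funext fun x => (hd x).deriv
  have hz : ∀ x, x ∉ Set.Icc (-r) r → η x = 0 := fun x hx =>
    image_eq_zero_of_notMem_tsupport fun h => hx (hr h)
  have hsupp : Function.support (prim η) ⊆ Set.Icc (-r) r := by
    intro x hx
    by_contra hxr
    refine hx ?_
    rcases lt_or_ge x (-r) with h | h
    · have : ∫ t in (-1 : ℝ)..x, η t = ∫ t in (-1 : ℝ)..x, (0 : ℝ) := by
        refine intervalIntegral.integral_congr fun t ht => hz t fun ht' => ?_
        have := ht.2
        have h2 : max (-1) x < -r := max_lt (by linarith) h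
        linarith [ht'.1]
      simpa [prim] using this
    · have hxr' : r < x := by
        by_contra h'
        exact hxr ⟨h, not_lt.1 h'⟩
      rw [prim, intervalIntegral.integral_eq_integral_of_support_subset, h0]
      intro t ht
      have := hr (subset_tsupport _ ht)
      exact ⟨by linarith [this.1], by linarith [this.2]⟩
  have hts : tsupport (prim η) ⊆ Set.Icc (-r) r := closure_minimal hsupp isClosed_Icc
  refine ⟨prim η, ?_, HasCompactSupport.of_support_subset_isCompact isCompact_Icc hsupp, ?_,
    hderiv⟩
  · rw [contDiff_infty_iff_deriv, hderiv]
    exact ⟨fun x => (hd x).differentiableAt, hη⟩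
  · exact hts.trans fun x hx => ⟨by linarith [hx.1], by linarith [hx.2]⟩

/-- The lemma of du Bois-Reymond on `I`. -/
theorem ae_const_of_integral_deriv_eq_zero {v : ℝ → ℝ} (hv : LocallyIntegrableOn v dom)
    (h : ∀ φ : ℝ → ℝ, ContDiff ℝ ∞ φ → HasCompactSupport φ → tsupport φ ⊆ dom →
      ∫ x in dom, v x * deriv φ x = 0) :
    ∃ c : ℝ, v =ᵐ[volume.restrict dom] fun _ => c := by
  let b : ContDiffBump (0 : ℝ) := ⟨1 / 4, 1 / 2, by norm_num, by norm_num⟩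
  let ψ : ℝ → ℝ := b.normed volume
  have hψ : ContDiff ℝ ∞ ψ := b.contDiff_normed
  have hψc : HasCompactSupport ψ := b.hasCompactSupport_normed
  have hψs : tsupport ψ ⊆ dom := by
    rw [b.tsupport_normed_eq, Real.closedBall_eq_Icc]
    intro x hx
    have h1 := hx.1
    have h2 := hx.2
    simp only [b] at h1 h2
    exact ⟨by linarith, by linarith⟩
  have hψ1 : ∫ x, ψ x = 1 := b.integral_normed
  refine ⟨∫ x in dom, v x * ψ x, ?_⟩
  set c := ∫ x in dom, v x * ψ x with hcdef
  have key : ∀ᵐ x ∂volume, x ∈ dom → v x - c = 0 := by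
    refine isOpen_Ioo.ae_eq_zero_of_integral_contDiff_smul_eq_zero
      (hv.sub ((locallyIntegrable_const c).locallyIntegrableOn dom)) ?_
    intro φ hφ hφc hφs
    have hφi : Integrable φ := hφ.continuous.integrable_of_hasCompactSupport hφc
    have hψi : Integrable ψ := hψ.continuous.integrable_of_hasCompactSupport hψc
    -- Subtracting `a` times the normalized bump makes the mean zero, so that the difference is the
    -- derivative of a test function.
    set a := ∫ x, φ x with ha
    have hη0 : ∫ x, (φ x - a * ψ x) = 0 := by
      rw [integral_sub hφi (hψi.const_mul a), integral_const_mul, hψ1]; simp [ha]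
    have hηs : tsupport (fun x => φ x - a * ψ x) ⊆ tsupport φ ∪ tsupport ψ := by
      refine closure_minimal ?_ ((isClosed_tsupport φ).union (isClosed_tsupport ψ))
      intro x hx
      by_contra hx'
      simp only [Set.mem_union, not_or] at hx'
      refine hx ?_
      simp [image_eq_zero_of_notMem_tsupport hx'.1, image_eq_zero_of_notMem_tsupport hx'.2]
    obtain ⟨χ, hχ, hχc, hχs, hχd⟩ := exists_test_primitive
      (hφ.sub (contDiff_const.mul hψ))
      (IsCompact.of_isClosed_subset (hφc.isCompact.union hψc.isCompact) (isClosed_tsupport _) hηs)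
      (hηs.trans (Set.union_subset hφs hψs)) hη0
    have h1 := h χ hχ hχc hχs
    rw [hχd] at h1
    have h2 : ∫ x in dom, v x * (φ x - a * ψ x) = (∫ x in dom, v x * φ x) - a * c := by
      rw [hcdef, ← integral_const_mul, ← integral_sub
        (integrableOn_mul_test hv hφ.continuous hφc hφs)
        ((integrableOn_mul_test hv hψ.continuous hψc hψs).const_mul a)]
      exact integral_congr_ae (.of_forall fun x => by ring)
    have hz : ∫ x, φ x • (v x - c) = ∫ x in dom, φ x • (v x - c) :=
      (setIntegral_eq_integral_of_forall_compl_eq_zero fun x hx => by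
        simp [test_eq_zero hφs hx]).symm
    have hz2 : ∫ x in dom, φ x = a :=
      setIntegral_eq_integral_of_forall_compl_eq_zero fun x hx => test_eq_zero hφs hx
    have h3 : ∫ x in dom, φ x • (v x - c) = (∫ x in dom, v x * φ x) - c * a := by
      rw [← hz2, ← integral_const_mul, ← integral_sub
        (integrableOn_mul_test hv hφ.continuous hφc hφs) (hφi.integrableOn.const_mul c)]
      exact integral_congr_ae (.of_forall fun x => by simp only [smul_eq_mul]; ring)
    rw [hz, h3]
    change ∫ x in dom, v x * (φ x - a * ψ x) = 0 at h1
    linarith [h1, h2]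
  refine (ae_restrict_iff' measurableSet_Ioo).2 ?_
  filter_upwards [key] with x hx hxd
  exact sub_eq_zero.1 (hx hxd)

theorem integrableOn_of_continuousOn {g : ℝ → ℝ} (hg : ContinuousOn g (Set.Icc (-1) 1)) :
    IntegrableOn g dom := (hg.integrableOn_Icc).mono_set Set.Ioo_subset_Icc_self

/-- A function with an integrable weak derivative is, up to a constant, its primitive. -/
theorem HasWeakDeriv.ae_eq_prim {u g : ℝ → ℝ} (h : HasWeakDeriv 1 u g)
    (hg : IntegrableOn g dom) :
    ∃ c : ℝ, u =ᵐ[volume.restrict dom] fun x => c + prim g x := by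
  have hp : IntegrableOn (prim g) dom := integrableOn_of_continuousOn (continuousOn_prim hg)
  obtain ⟨c, hc⟩ := ae_const_of_integral_deriv_eq_zero (h.1.sub hp.locallyIntegrableOn) (by
    intro φ hφ hφc hφs
    have hd : ContDiff ℝ ∞ (deriv φ) := (contDiff_infty_iff_deriv.1 hφ).2
    have hdc : HasCompactSupport (deriv φ) := hφc.deriv
    have hds : tsupport (deriv φ) ⊆ dom := tsupport_deriv_subset.trans hφs
    have hdi : IntegrableOn (deriv φ) dom := integrableOn_of_continuousOn hd.continuous.continuousOn
    have hφp : ∀ x ∈ Set.Icc (-1 : ℝ) 1, φ x = prim (deriv φ) x := by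
      intro x hx
      have := eq_prim_of_hasDerivAt hφ.continuous.continuousOn (fun x _ =>
        ((contDiff_infty_iff_deriv.1 hφ).1 x).hasDerivAt) hdi hx
      rw [this, test_eq_zero hφs (by simp [dom]), zero_add]
    have h1 : ∫ x in dom, u x * deriv φ x = - ∫ x in dom, g x * φ x := by
      have := h.2.2 φ hφ hφc hφs
      simpa [iteratedDeriv_one] using this
    have h2 := integral_prim_mul hg hdi
    rw [← hφp 1 (by simp), test_eq_zero hφs (by simp [dom])] at h2
    have h3 : ∫ x in dom, g x * prim (deriv φ) x = ∫ x in dom, g x * φ x :=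
      setIntegral_congr_fun measurableSet_Ioo fun x hx => by
        simp only [hφp x (Set.Ioo_subset_Icc_self hx)]
    have h4 : ∫ x in dom, (u - prim g) x * deriv φ x
        = (∫ x in dom, u x * deriv φ x) - ∫ x in dom, prim g x * deriv φ x := by
      rw [← integral_sub (integrableOn_mul_test h.1 hd.continuous hdc hds)
        (integrableOn_mul_test hp.locallyIntegrableOn hd.continuous hdc hds)]
      exact integral_congr_ae (.of_forall fun x => by simp only [Pi.sub_apply]; ring)
    rw [h4, h1, h2, h3]; ring)
  refine ⟨c, ?_⟩
  filter_upwards [hc] with x hx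
  simp only [Pi.sub_apply] at hx
  linarith

/-- Consecutive weak derivatives are weak derivatives of each other. -/
theorem HasWeakDeriv.of_succ {k : ℕ} {u g h : ℝ → ℝ} (hg : HasWeakDeriv k u g)
    (hh : HasWeakDeriv (k + 1) u h) : HasWeakDeriv 1 g h := by
  refine ⟨hg.2.1, hh.2.1, fun φ hφ hφc hφs => ?_⟩
  have h1 := hg.2.2 (deriv φ) (contDiff_infty_iff_deriv.1 hφ).2 hφc.deriv
    (tsupport_deriv_subset.trans hφs)
  have h2 := hh.2.2 φ hφ hφc hφs
  rw [iteratedDeriv_succ'] at h2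
  rw [h2] at h1
  have h3 : ((-1 : ℝ)) ^ k * ((-1) ^ k) = 1 := by rw [← mul_pow]; simp
  rw [iteratedDeriv_one]
  linear_combination (-(-1 : ℝ) ^ k) * h1 +
    (-(∫ x in dom, g x * deriv φ x) - ∫ x in dom, h x * φ x) * h3

theorem weakDeriv_ae_eq {k : ℕ} {u g : ℝ → ℝ} (h : HasWeakDeriv k u g) :
    weakDeriv k u =ᵐ[volume.restrict dom] g := by
  have hex : ∃ g, HasWeakDeriv k u g := ⟨g, h⟩
  rw [weakDeriv, dif_pos hex]
  exact hex.choose_spec.ae_eq h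

/-- Functions continuous on `[-1, 1]` and differentiable inside have their derivative as weak
derivative. -/
theorem hasWeakDeriv_of_hasDerivAt {F F' : ℝ → ℝ} (hF : ContinuousOn F (Set.Icc (-1) 1))
    (hd : ∀ x ∈ dom, HasDerivAt F (F' x) x) (hi : IntegrableOn F' dom) :
    HasWeakDeriv 1 F F' := by
  refine ⟨(integrableOn_of_continuousOn hF).locallyIntegrableOn, hi.locallyIntegrableOn,
    fun φ hφ hφc hφs => ?_⟩
  have hdφ : ContDiff ℝ ∞ (deriv φ) := (contDiff_infty_iff_deriv.1 hφ).2
  have e1 : ∀ x ∈ dom, HasDerivAt (fun x => F x * φ x) (F' x * φ x + F x * deriv φ x) x :=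
    fun x hx => (hd x hx).mul ((contDiff_infty_iff_deriv.1 hφ).1 x).hasDerivAt
  have i1 : IntegrableOn (fun x => F' x * φ x) dom :=
    integrableOn_mul_test hi.locallyIntegrableOn hφ.continuous hφc hφs
  have i2 : IntegrableOn (fun x => F x * deriv φ x) dom :=
    integrableOn_of_continuousOn (hF.mul hdφ.continuous.continuousOn)
  have h := eq_prim_of_hasDerivAt (hF.mul hφ.continuous.continuousOn) e1 (i1.add i2)
    (x := 1) (by simp)
  rw [prim_one] at h
  have h2 := integral_add i1 i2
  simp only [Pi.mul_apply, test_eq_zero hφs (x := 1) (by simp [dom]),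
    test_eq_zero hφs (x := -1) (by simp [dom])] at h
  simp only [iteratedDeriv_one]
  linarith

/-! ### The weight and the weighted inner product. -/

/-- Square integrability on `I`. -/
abbrev L2dom (f : ℝ → ℝ) : Prop := MemLp f 2 (volume.restrict dom)

theorem weight_nonneg (x : ℝ) : 0 ≤ weight x := Real.sqrt_nonneg _

theorem weight_le_one (x : ℝ) : weight x ≤ 1 := by
  exact Real.sqrt_le_one.2 (by nlinarith [sq_nonneg x])

theorem continuous_weight : Continuous weight := by unfold weight; fun_prop

theorem one_sub_sq_pos {x : ℝ} (hx : x ∈ dom) : 0 < 1 - x ^ 2 := by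
  have h1 := hx.1
  have h2 := hx.2
  nlinarith

theorem weight_pos {x : ℝ} (hx : x ∈ dom) : 0 < weight x := Real.sqrt_pos.2 (one_sub_sq_pos hx)

theorem weight_sq {x : ℝ} (hx : x ∈ dom) : weight x ^ 2 = 1 - x ^ 2 :=
  Real.sq_sqrt (one_sub_sq_pos hx).le

@[simp] theorem weight_one : weight 1 = 0 := by simp [weight]

@[simp] theorem weight_neg_one : weight (-1) = 0 := by simp [weight]

theorem hasDerivAt_weight {x : ℝ} (hx : x ∈ dom) : HasDerivAt weight (-x / weight x) x := by
  have h : HasDerivAt (fun y : ℝ => 1 - y ^ 2) (-(2 * x)) x := by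
    simpa using ((hasDerivAt_id x).pow 2).const_sub 1
  have := h.sqrt (one_sub_sq_pos hx).ne'
  convert! this using 1
  rw [weight]
  field_simp

theorem integrableOn_inv_weight : IntegrableOn (fun x => (weight x)⁻¹) dom := by
  rw [integrableOn_dom_iff]
  simpa [weight] using Chebyshev.intervalIntegrable_sqrt_one_sub_sq_inv

theorem integral_measureT_eq_dom (f : ℝ → ℝ) :
    ∫ x, f x ∂Chebyshev.measureT = ∫ x in dom, f x * (weight x)⁻¹ := by
  rw [Chebyshev.integral_measureT, integral_dom]
  simp [weight]

theorem integral_inv_weight : ∫ x in dom, (weight x)⁻¹ = Real.pi := by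
  have := Chebyshev.integral_eval_T_real_measureT_zero
  rw [integral_measureT_eq_dom] at this
  simpa using this

theorem memLp_of_continuousOn {f : ℝ → ℝ} (hf : ContinuousOn f (Set.Icc (-1) 1)) : L2dom f := by
  obtain ⟨C, hC⟩ := isCompact_Icc.exists_bound_of_continuousOn hf
  exact MemLp.of_bound ((hf.mono Set.Ioo_subset_Icc_self).aestronglyMeasurable measurableSet_Ioo) C
    ((ae_restrict_iff' measurableSet_Ioo).2 (.of_forall fun x hx =>
      hC x (Set.Ioo_subset_Icc_self hx)))

theorem memLp_eval (p : ℝ[X]) : L2dom (fun x => p.eval x) :=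
  memLp_of_continuousOn p.continuous.continuousOn

theorem L2dom.integrableOn {f : ℝ → ℝ} (hf : L2dom f) : IntegrableOn f dom :=
  hf.integrable (by norm_num)

/-- The weighted inner product `∫_I ω f g`. -/
noncomputable def wip (f g : ℝ → ℝ) : ℝ := ∫ x in dom, weight x * f x * g x

theorem integrable_weight_mul_mul {f g : ℝ → ℝ} (hf : L2dom f) (hg : L2dom g) :
    IntegrableOn (fun x => weight x * f x * g x) dom := by
  have h1 : IntegrableOn (fun x => f x * g x) dom := hf.integrable_mul hg
  have := h1.bdd_mul (c := 1) (f := weight) continuous_weight.aestronglyMeasurable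
    (.of_forall fun x => by rw [Real.norm_of_nonneg (weight_nonneg x)]; exact weight_le_one x)
  exact this.congr (.of_forall fun x => by simp only; ring)

theorem wip_comm (f g : ℝ → ℝ) : wip f g = wip g f :=
  integral_congr_ae (.of_forall fun x => by simp only; ring)

theorem wip_congr {f f' g g' : ℝ → ℝ} (hf : f =ᵐ[volume.restrict dom] f')
    (hg : g =ᵐ[volume.restrict dom] g') : wip f g = wip f' g' := by
  refine integral_congr_ae ?_
  filter_upwards [hf, hg] with x h1 h2
  rw [h1, h2]

theorem wip_self_nonneg (f : ℝ → ℝ) : 0 ≤ wip f f :=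
  integral_nonneg fun x => by
    rw [Pi.zero_apply, mul_assoc]; exact mul_nonneg (weight_nonneg x) (mul_self_nonneg _)

theorem wip_add_right {f g h : ℝ → ℝ} (hf : L2dom f) (hg : L2dom g) (hh : L2dom h) :
    wip f (fun x => g x + h x) = wip f g + wip f h := by
  rw [wip, wip, wip, ← integral_add (integrable_weight_mul_mul hf hg)
    (integrable_weight_mul_mul hf hh)]
  exact integral_congr_ae (.of_forall fun x => by simp only; ring)

theorem wip_sub_right {f g h : ℝ → ℝ} (hf : L2dom f) (hg : L2dom g) (hh : L2dom h) :
    wip f (fun x => g x - h x) = wip f g - wip f h := by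
  rw [wip, wip, wip, ← integral_sub (integrable_weight_mul_mul hf hg)
    (integrable_weight_mul_mul hf hh)]
  exact integral_congr_ae (.of_forall fun x => by simp only; ring)

theorem wip_sub_left {f g h : ℝ → ℝ} (hf : L2dom f) (hg : L2dom g) (hh : L2dom h) :
    wip (fun x => f x - g x) h = wip f h - wip g h := by
  rw [wip_comm, wip_sub_right hh hf hg, wip_comm h f, wip_comm h g]

theorem wip_const_mul_right (f g : ℝ → ℝ) (c : ℝ) : wip f (fun x => c * g x) = c * wip f g := by
  rw [wip, wip, ← integral_const_mul]
  exact integral_congr_ae (.of_forall fun x => by simp only; ring)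

/-- Pairing with polynomials, as a linear map. -/
noncomputable def wipPoly (f : ℝ → ℝ) (hf : L2dom f) : ℝ[X] →ₗ[ℝ] ℝ where
  toFun p := wip f (fun x => p.eval x)
  map_add' p q := by
    simp only [eval_add]; exact wip_add_right hf (memLp_eval p) (memLp_eval q)
  map_smul' c p := by
    simp only [eval_smul, smul_eq_mul, RingHom.id_apply]; exact wip_const_mul_right _ _ _

theorem wipPoly_apply {f : ℝ → ℝ} (hf : L2dom f) (p : ℝ[X]) :
    wipPoly f hf p = wip f (fun x => p.eval x) := rfl

theorem wip_self_le {f : ℝ → ℝ} (hf : L2dom f) : wip f f ≤ ∫ x in dom, f x ^ 2 := by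
  refine integral_mono (integrable_weight_mul_mul hf hf) hf.integrable_sq fun x => ?_
  simp only [mul_assoc, ← sq]
  exact mul_le_of_le_one_left (sq_nonneg _) (weight_le_one x)

/-- Cauchy-Schwarz against `1/√ω · √ω`. -/
theorem sq_integral_abs_le {f : ℝ → ℝ} (hf : L2dom f) :
    (∫ x in dom, |f x|) ^ 2 ≤ Real.pi * wip f f := by
  set a := ∫ x in dom, |f x| with ha
  have hi : IntegrableOn (fun x => |f x|) dom := hf.integrableOn.abs
  -- This `c` minimizes `∫ ω (|f| - c/ω)²`, because `∫ 1/ω = π`; nonnegativity of the minimum is the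
  -- claim.
  set c := a / Real.pi with hc
  have h0 : 0 ≤ ∫ x in dom, weight x * (|f x| - c * (weight x)⁻¹) ^ 2 :=
    integral_nonneg fun x => mul_nonneg (weight_nonneg x) (sq_nonneg _)
  have h1 : ∫ x in dom, weight x * (|f x| - c * (weight x)⁻¹) ^ 2
      = ∫ x in dom, (weight x * f x * f x - (2 * c) * |f x| + c ^ 2 * (weight x)⁻¹) := by
    refine setIntegral_congr_fun measurableSet_Ioo fun x hx => ?_
    have := (weight_pos hx).ne'
    have h2 : |f x| ^ 2 = f x ^ 2 := sq_abs _
    field_simp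
    rw [sub_sq, mul_pow, h2]
    ring
  have h5 : IntegrableOn (fun x => weight x * f x * f x - (2 * c) * |f x|) dom :=
    (integrable_weight_mul_mul hf hf).sub (hi.const_mul _)
  rw [h1, integral_add h5
    (integrableOn_inv_weight.const_mul _), integral_sub (integrable_weight_mul_mul hf hf)
    (hi.const_mul _), integral_const_mul, integral_const_mul, integral_inv_weight, ← ha] at h0
  have hp := Real.pi_pos
  have h3 : 0 ≤ wip f f - 2 * c * a + c ^ 2 * Real.pi := h0
  have h4 : c * Real.pi = a := by rw [hc]; field_simp
  nlinarith [mul_nonneg hp.le h3]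

theorem abs_prim_le {f : ℝ → ℝ} (hf : IntegrableOn f dom) {x : ℝ}
    (hx : x ∈ Set.Icc (-1 : ℝ) 1) : |prim f x| ≤ ∫ t in dom, |f t| := by
  refine (intervalIntegral.abs_integral_le_integral_abs hx.1).trans ?_
  rw [intervalIntegral.integral_of_le hx.1, integral_Ioc_eq_integral_Ioo]
  exact setIntegral_mono_set hf.abs (.of_forall fun _ => abs_nonneg _)
    (Set.Ioo_subset_Ioo_right hx.2).eventuallyLE

/-- Convergence in the weighted norm therefore implies uniform convergence of primitives, which lets
endpoint values pass to the limit. -/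
theorem sq_prim_le {f : ℝ → ℝ} (hf : L2dom f) {x : ℝ} (hx : x ∈ Set.Icc (-1 : ℝ) 1) :
    prim f x ^ 2 ≤ Real.pi * wip f f :=
  (sq_le_sq' (by linarith [abs_prim_le hf.integrableOn hx, neg_abs_le (prim f x)])
    ((le_abs_self _).trans (abs_prim_le hf.integrableOn hx))).trans (sq_integral_abs_le hf)

/-! ### Orthogonal expansion in Chebyshev polynomials of the second kind. -/

/-- The Chebyshev polynomials of the second kind, as functions. -/
noncomputable def Ue (k : ℕ) (x : ℝ) : ℝ := (Chebyshev.U ℝ k).eval x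

theorem memLp_Ue (k : ℕ) : L2dom (Ue k) := memLp_eval _

/-- Under `x = cos θ` the integrand becomes `sin((j+1)θ) sin((k+1)θ)`, and product-to-sum turns it
into a difference of two `T` polynomials, whose integrals are known. -/
theorem wip_Ue_Ue (j k : ℕ) : wip (Ue j) (Ue k) = if j = k then Real.pi / 2 else 0 := by
  have h1 : wip (Ue j) (Ue k) = ∫ x, (1 - x ^ 2) * (Ue j x * Ue k x) ∂Chebyshev.measureT := by
    rw [integral_measureT_eq_dom]
    refine setIntegral_congr_fun measurableSet_Ioo fun x hx => ?_
    have := (weight_pos hx).ne'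
    simp only [← weight_sq hx]
    field_simp
  have h2 : ∀ θ : ℝ, (1 - Real.cos θ ^ 2) * (Ue j (Real.cos θ) * Ue k (Real.cos θ))
      = ((Chebyshev.T ℝ (j - k : ℤ)).eval (Real.cos θ)
        - (Chebyshev.T ℝ (j + k + 2 : ℤ)).eval (Real.cos θ)) / 2 := by
    intro θ
    have e1 := Chebyshev.U_real_cos θ j
    have e2 := Chebyshev.U_real_cos θ k
    rw [Chebyshev.T_real_cos, Chebyshev.T_real_cos, ← Real.sin_sq]
    have e3 : Real.sin θ ^ 2 * (Ue j (Real.cos θ) * Ue k (Real.cos θ))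
        = Real.sin (((j : ℤ) + 1) * θ) * Real.sin (((k : ℤ) + 1) * θ) := by
      rw [← e1, ← e2, Ue, Ue]; ring
    rw [e3]
    have a1 : ((j - k : ℤ) : ℝ) * θ = ((j : ℤ) + 1) * θ - ((k : ℤ) + 1) * θ := by
      push_cast; ring
    have a2 : ((j + k + 2 : ℤ) : ℝ) * θ = ((j : ℤ) + 1) * θ + ((k : ℤ) + 1) * θ := by
      push_cast; ring
    rw [a1, a2, Real.cos_sub, Real.cos_add]
    ring
  have h3 : wip (Ue j) (Ue k) = ((∫ x, (Chebyshev.T ℝ (j - k : ℤ)).eval x ∂Chebyshev.measureT)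
      - ∫ x, (Chebyshev.T ℝ (j + k + 2 : ℤ)).eval x ∂Chebyshev.measureT) / 2 := by
    rw [h1, Chebyshev.integral_measureT_eq_integral_cos]
    simp_rw [h2]
    rw [← Chebyshev.integral_measureT_eq_integral_cos (f := fun x =>
      ((Chebyshev.T ℝ (j - k : ℤ)).eval x - (Chebyshev.T ℝ (j + k + 2 : ℤ)).eval x) / 2),
      integral_div, integral_sub]
    · exact Chebyshev.integrable_measureT (Polynomial.continuous _).continuousOn
    · exact Chebyshev.integrable_measureT (Polynomial.continuous _).continuousOn
  rw [h3, Chebyshev.integral_eval_T_real_measureT_of_ne_zero (n := j + k + 2) (by positivity)]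
  split_ifs with h
  · subst h
    rw [sub_self, Chebyshev.integral_eval_T_real_measureT_zero]; ring
  · rw [Chebyshev.integral_eval_T_real_measureT_of_ne_zero (by lia)]; ring

/-- Chebyshev coefficients with respect to the polynomials of the second kind. -/
noncomputable def coef (f : ℝ → ℝ) (k : ℕ) : ℝ := 2 / Real.pi * wip f (Ue k)

theorem wip_Ue_right (f : ℝ → ℝ) (k : ℕ) : wip f (Ue k) = Real.pi / 2 * coef f k := by
  rw [coef]; field_simp

/-- Partial sums of the expansion in Chebyshev polynomials of the second kind. -/
noncomputable def partialU (f : ℝ → ℝ) (n : ℕ) : ℝ[X] :=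
  ∑ k ∈ Finset.range n, coef f k • Chebyshev.U ℝ k

theorem wip_partialU {f g : ℝ → ℝ} (hf : L2dom f) (n : ℕ) :
    wip f (fun x => (partialU g n).eval x)
      = Real.pi / 2 * ∑ k ∈ Finset.range n, coef g k * coef f k := by
  rw [← wipPoly_apply hf, partialU, map_sum, Finset.mul_sum]
  refine Finset.sum_congr rfl fun k _ => ?_
  rw [map_smul, wipPoly_apply]
  change coef g k * wip f (Ue k) = _
  rw [wip_Ue_right]; ring

theorem coef_Ue (j k : ℕ) : coef (Ue j) k = if j = k then 1 else 0 := by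
  rw [coef, wip_Ue_Ue]; split_ifs <;> simp

theorem coef_partialU {f : ℝ → ℝ} {n k : ℕ} :
    coef (fun x => (partialU f n).eval x) k = if k < n then coef f k else 0 := by
  rw [coef, wip_comm]
  change 2 / Real.pi * wip (Ue k) _ = _
  rw [wip_partialU (memLp_Ue k), ← mul_assoc]
  have : (2 / Real.pi * (Real.pi / 2)) = 1 := by field_simp
  rw [this, one_mul]
  simp [coef_Ue]

theorem coef_sub {f g : ℝ → ℝ} (hf : L2dom f) (hg : L2dom g) (k : ℕ) :
    coef (fun x => f x - g x) k = coef f k - coef g k := by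
  rw [coef, wip_sub_left hf hg (memLp_Ue k), coef, coef]; ring

theorem coef_congr {f g : ℝ → ℝ} (h : f =ᵐ[volume.restrict dom] g) (k : ℕ) :
    coef f k = coef g k := by
  rw [coef, coef, wip_congr h .rfl]

theorem wip_sub_partialU_self {f : ℝ → ℝ} (hf : L2dom f) (n : ℕ) :
    wip (fun x => f x - (partialU f n).eval x) (fun x => f x - (partialU f n).eval x)
      = wip f f - Real.pi / 2 * ∑ k ∈ Finset.range n, coef f k ^ 2 := by
  have hS := memLp_eval (partialU f n)
  have hfS : L2dom (fun x => f x - (partialU f n).eval x) := hf.sub hS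
  rw [wip_sub_right hfS hf hS, wip_sub_left hf hS hf, wip_sub_left hf hS hS,
    wip_comm (fun x => (partialU f n).eval x) f, wip_partialU hf, wip_partialU hS]
  have : ∀ k ∈ Finset.range n, coef f k * coef (fun x => (partialU f n).eval x) k
      = coef f k * coef f k := fun k hk => by
    rw [coef_partialU, if_pos (Finset.mem_range.1 hk)]
  rw [Finset.sum_congr rfl this]
  simp_rw [sq]; ring

/-- Bessel's inequality. -/
theorem sum_coef_sq_le {f : ℝ → ℝ} (hf : L2dom f) (n : ℕ) :
    Real.pi / 2 * ∑ k ∈ Finset.range n, coef f k ^ 2 ≤ wip f f := by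
  have := wip_self_nonneg (fun x => f x - (partialU f n).eval x)
  rw [wip_sub_partialU_self hf] at this
  linarith

/-- The Chebyshev polynomials of the second kind as a polynomial sequence. -/
noncomputable def chebyshevUSequence : Polynomial.Sequence ℝ where
  elems' n := Chebyshev.U ℝ n
  degree_eq' n := Chebyshev.degree_U_natCast ℝ n

theorem mem_span_U {p : ℝ[X]} {n : ℕ} (hp : p.degree < n) :
    p ∈ Submodule.span ℝ ((fun k : ℕ => Chebyshev.U ℝ k) '' Set.Iio n) := by
  have h := chebyshevUSequence.span_degreeLT (m := n) (fun i _ => by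
    rw [isUnit_iff_ne_zero]
    exact leadingCoeff_ne_zero.2 (chebyshevUSequence.ne_zero i))
  have h2 : p ∈ degreeLT ℝ n := mem_degreeLT.2 hp
  rw [← h] at h2
  exact h2

/-- Polynomials of degree less than `n` are orthogonal to `U_k`, `k ≥ n`. -/
theorem coef_eval_eq_zero {p : ℝ[X]} {n k : ℕ} (hp : p.degree < n) (hk : n ≤ k) :
    coef (fun x => p.eval x) k = 0 := by
  have h : wipPoly (Ue k) (memLp_Ue k) p = 0 := by
    refine Submodule.span_induction (p := fun q _ => wipPoly (Ue k) (memLp_Ue k) q = 0)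
      ?_ (map_zero _) ?_ ?_ (mem_span_U hp)
    · rintro _ ⟨j, hj, rfl⟩
      change wip (Ue k) (Ue j) = 0
      rw [wip_Ue_Ue, if_neg]
      have : j < n := hj
      omega
    · intro x y _ _ hx hy; rw [map_add, hx, hy, add_zero]
    · intro a x _ hx; rw [map_smul, hx, smul_zero]
  rw [coef, wip_comm]
  change 2 / Real.pi * wipPoly (Ue k) (memLp_Ue k) p = 0
  rw [h, mul_zero]

theorem partialU_eval {p : ℝ[X]} {n : ℕ} (hp : p.degree < n) :
    partialU (fun x => p.eval x) n = p := by
  have key : ∀ q ∈ Submodule.span ℝ ((fun k : ℕ => Chebyshev.U ℝ k) '' Set.Iio n),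
      partialU (fun x => q.eval x) n = q := by
    intro q hq
    induction hq using Submodule.span_induction with
    | mem x hx =>
      obtain ⟨j, hj, rfl⟩ := hx
      have hj : j < n := hj
      change partialU (Ue j) n = _
      simp [partialU, coef_Ue, hj]
    | zero =>
      simp [partialU, coef, wip]
    | add x y _ _ hx hy =>
      nth_rewrite 2 [← hx]
      nth_rewrite 2 [← hy]
      rw [partialU, partialU, partialU, ← Finset.sum_add_distrib]
      refine Finset.sum_congr rfl fun k _ => ?_
      rw [← add_smul]
      simp only [coef, eval_add]
      rw [wip_comm, wip_add_right (memLp_Ue k) (memLp_eval x) (memLp_eval y), mul_add,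
        wip_comm (Ue k), wip_comm (Ue k)]
    | smul a x _ hx =>
      nth_rewrite 2 [← hx]
      rw [partialU, partialU, Finset.smul_sum]
      refine Finset.sum_congr rfl fun k _ => ?_
      rw [smul_smul]
      simp only [coef, eval_smul, smul_eq_mul]
      rw [wip_comm, wip_const_mul_right, wip_comm (Ue k)]
      ring_nf
  exact key p (mem_span_U hp)

/-- Best approximation property of the partial sums. -/
theorem wip_sub_partialU_le {f : ℝ → ℝ} (hf : L2dom f) {p : ℝ[X]} {n : ℕ} (hp : p.degree < n) :
    wip (fun x => f x - (partialU f n).eval x) (fun x => f x - (partialU f n).eval x)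
      ≤ wip (fun x => f x - p.eval x) (fun x => f x - p.eval x) := by
  have hS := memLp_eval (partialU f n)
  have hP := memLp_eval p
  have hg : L2dom (fun x => f x - p.eval x) := hf.sub hP
  -- Subtracting `p` leaves the remainder after `n` terms unchanged, so the remainder identity for
  -- `f - p` gives the bound.
  have h := sum_coef_sq_le hg n
  have h1 : partialU (fun x => f x - p.eval x) n = partialU f n - p := by
    nth_rewrite 2 [← partialU_eval hp]
    rw [partialU, partialU, partialU, ← Finset.sum_sub_distrib]
    exact Finset.sum_congr rfl fun k _ => by rw [coef_sub hf hP, sub_smul]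
  have h2 := wip_sub_partialU_self hg n
  rw [h1] at h2
  have h3 : (fun x => f x - p.eval x - (partialU f n - p).eval x)
      = fun x => f x - (partialU f n).eval x := by
    funext x; rw [eval_sub]; ring
  rw [h3] at h2
  rw [h2]
  have : 0 ≤ Real.pi / 2 * ∑ k ∈ Finset.range n, coef (fun x => f x - p.eval x) k ^ 2 := by
    have := Real.pi_pos
    positivity
  linarith

/-- The partial sums of a continuous function converge in the weighted norm. -/
theorem exists_wip_sub_partialU_le {f : ℝ → ℝ} (hf : ContinuousOn f (Set.Icc (-1) 1))
    {ε : ℝ} (hε : 0 < ε) :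
    ∃ n₀, ∀ n ≥ n₀, wip (fun x => f x - (partialU f n).eval x)
      (fun x => f x - (partialU f n).eval x) ≤ ε := by
  -- Weierstrass approximation; the interval has length 2, hence the `ε / 2`.
  obtain ⟨p, hp⟩ := exists_polynomial_near_of_continuousOn (-1) 1 f hf (Real.sqrt (ε / 2))
    (Real.sqrt_pos.2 (by linarith))
  refine ⟨p.natDegree + 1, fun n hn => ?_⟩
  have hf2 := memLp_of_continuousOn hf
  have hfp : L2dom (fun x => f x - p.eval x) := hf2.sub (memLp_eval p)
  refine (wip_sub_partialU_le hf2 (p := p) ?_).trans ((wip_self_le hfp).trans ?_)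
  · refine p.degree_le_natDegree.trans_lt ?_
    exact_mod_cast hn
  · have h1 : ∫ x in dom, (f x - p.eval x) ^ 2 ≤ ∫ x in dom, ε / 2 := by
      refine setIntegral_mono_on hfp.integrable_sq (integrable_const _) measurableSet_Ioo
        fun x hx => ?_
      have h := (hp x (Set.Ioo_subset_Icc_self hx)).le
      rw [abs_sub_comm] at h
      have h2 := pow_le_pow_left₀ (abs_nonneg _) h 2
      rwa [sq_abs, Real.sq_sqrt (by linarith)] at h2
    refine h1.trans ?_
    simp [dom]
    linarith

/-! ### Decay of the coefficients of antiderivatives. -/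

/-- With `x = cos θ`, `ω U_n` is `sin((n+1)θ)`, and `dx = -sin θ dθ`. -/
theorem hasDerivAt_weight_mul_Ue (n : ℕ) {x : ℝ} (hx : x ∈ dom) :
    HasDerivAt (fun y => weight y * Ue n y)
      (-((n + 1) * (Chebyshev.T ℝ (n + 1)).eval x) / weight x) x := by
  have h := (hasDerivAt_weight hx).mul ((Chebyshev.U ℝ n).hasDerivAt x)
  have hw := (weight_pos hx).ne'
  have e := congrArg (eval x) (Chebyshev.add_one_mul_T_eq_poly_in_U (R := ℝ) n)
  simp only [eval_mul, eval_add, eval_sub, eval_pow, eval_X, eval_one, eval_intCast] at e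
  convert! h using 1
  push_cast at e
  rw [e, ← weight_sq hx]
  field_simp
  ring

/-- By the preceding formula this amounts to `T_{k+1} - T_{k+3} = 2 (1 - x²) U_{k+1}`. It provides
an explicit primitive of `ω U_{k+1}` that vanishes at both endpoints. -/
theorem hasDerivAt_weight_mul_Ue_comb (k : ℕ) {x : ℝ} (hx : x ∈ dom) :
    HasDerivAt (fun y => (weight y * Ue (k + 2) y / (k + 3) - weight y * Ue k y / (k + 1)) / 2)
      (weight x * Ue (k + 1) x) x := by
  have h := (((hasDerivAt_weight_mul_Ue (k + 2) hx).div_const ((k : ℝ) + 3)).sub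
    ((hasDerivAt_weight_mul_Ue k hx).div_const ((k : ℝ) + 1))).div_const 2
  have hw := (weight_pos hx).ne'
  have e1 := congrArg (eval x) (Chebyshev.one_sub_X_sq_mul_U_eq_pol_in_T ℝ (k + 1))
  have e2 := congrArg (eval x) (Chebyshev.T_add_two ℝ (k + 1))
  simp only [eval_mul, eval_sub, eval_pow, eval_X, eval_one, eval_ofNat] at e1 e2
  have c1 : ((k : ℤ) + 1 + 1) = k + 2 := by ring
  have c2 : ((k : ℤ) + 1 + 2) = k + 3 := by ring
  have c3 : (((k + 2 : ℕ) : ℤ) + 1) = k + 3 := by push_cast; ring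
  have c4 : (((k + 1 : ℕ) : ℤ)) = k + 1 := by push_cast; ring
  rw [c1, c2] at e1 e2
  convert! h using 1
  rw [Ue, c3, c4]
  push_cast
  have hk1 : (k : ℝ) + 1 ≠ 0 := by positivity
  have hk3 : (k : ℝ) + 3 ≠ 0 := by positivity
  have hk3' : (k : ℝ) + 2 + 1 = k + 3 := by ring
  rw [hk3']
  field_simp
  rw [weight_sq hx]
  linear_combination 2 * e1 - e2

/-- Chebyshev coefficients of a function in terms of those of its derivative. -/
theorem coef_succ_eq {h g : ℝ → ℝ} {c : ℝ} (hg : L2dom g)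
    (hh : h =ᵐ[volume.restrict dom] fun x => c + prim g x) (k : ℕ) :
    coef h (k + 1) = (coef g k / (k + 1) - coef g (k + 2) / (k + 3)) / 2 := by
  -- `Ψ` is the primitive of `ω U_{k+1}` vanishing at `±1`, so integration by parts has no boundary
  -- terms and the constant `c` drops out.
  set Ψ : ℝ → ℝ := fun y =>
    (weight y * Ue (k + 2) y / (k + 3) - weight y * Ue k y / (k + 1)) / 2 with hΨ
  set s : ℝ → ℝ := fun y => weight y * Ue (k + 1) y with hs
  have hUc : ∀ n, Continuous (Ue n) := fun n => Polynomial.continuous _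
  have hsc : Continuous s := continuous_weight.mul (hUc _)
  have hsi : IntegrableOn s dom := integrableOn_of_continuousOn hsc.continuousOn
  have hΨc : Continuous Ψ := by
    have := hUc k; have := hUc (k + 2); have := continuous_weight
    fun_prop
  have hΨp : ∀ x ∈ Set.Icc (-1 : ℝ) 1, prim s x = Ψ x := fun x hx => by
    have := eq_prim_of_hasDerivAt hΨc.continuousOn
      (fun y hy => hasDerivAt_weight_mul_Ue_comb k hy) hsi hx
    rw [this, hΨ]; simp; rfl
  have h1 : prim s 1 = 0 := by rw [hΨp 1 (by simp), hΨ]; simp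
  have e1 : wip h (Ue (k + 1)) = ∫ x in dom, (c * s x + prim g x * s x) := by
    refine integral_congr_ae ?_
    filter_upwards [hh] with x hx
    rw [hx]; simp only [hs]; ring
  have hpi : IntegrableOn (fun x => prim g x * s x) dom :=
    integrableOn_of_continuousOn ((continuousOn_prim hg.integrableOn).mul hsc.continuousOn)
  rw [integral_add (hsi.const_mul c) hpi, integral_const_mul, ← prim_one s, h1,
    integral_prim_mul hg.integrableOn hsi, h1] at e1
  have e2 : ∫ x in dom, g x * prim s x
      = wip g (fun x => (1 / (2 * (k + 3))) * Ue (k + 2) x - (1 / (2 * (k + 1))) * Ue k x) := by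
    refine setIntegral_congr_fun measurableSet_Ioo fun x hx => ?_
    simp only [hΨp x (Set.Ioo_subset_Icc_self hx), hΨ]
    have hk1 : (k : ℝ) + 1 ≠ 0 := by positivity
    have hk3 : (k : ℝ) + 3 ≠ 0 := by positivity
    field_simp
  rw [e2, wip_sub_right hg ((memLp_Ue _).const_mul _) ((memLp_Ue _).const_mul _),
    wip_const_mul_right, wip_const_mul_right] at e1
  rw [coef, e1, coef, coef]
  have hk1 : (k : ℝ) + 1 ≠ 0 := by positivity
  have hk3 : (k : ℝ) + 3 ≠ 0 := by positivity
  field_simp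
  ring

/-- From `((a - b)/2)² ≤ (a² + b²)/2`: the two shifted tails contribute at most `Q/2` each. The
starting index grows by one, a loss paid once per antiderivative. -/
theorem sum_sq_step {x y : ℕ → ℝ} {K : ℕ} {Q : ℝ}
    (h : ∀ k, x (k + 1) = (y k / (k + 1) - y (k + 2) / (k + 3)) / 2)
    (hy : ∀ n, ∑ k ∈ Finset.Ico K n, y k ^ 2 ≤ Q) (n : ℕ) :
    ∑ k ∈ Finset.Ico (K + 1) n, x k ^ 2 ≤ Q / ((K : ℝ) + 1) ^ 2 := by
  have hmono : ∑ k ∈ Finset.Ico (K + 1) n, x k ^ 2 ≤ ∑ k ∈ Finset.Ico (K + 1) (n + 1), x k ^ 2 :=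
    Finset.sum_le_sum_of_subset_of_nonneg (Finset.Ico_subset_Ico_right (by omega))
      fun _ _ _ => sq_nonneg _
  refine hmono.trans ?_
  rw [← Finset.sum_Ico_add' (fun k => x k ^ 2) K n 1]
  have hK : (0 : ℝ) < (K : ℝ) + 1 := by positivity
  have hb : ∀ k ∈ Finset.Ico K n, x (k + 1) ^ 2
      ≤ (y k ^ 2 + y (k + 2) ^ 2) / 2 / ((K : ℝ) + 1) ^ 2 := by
    intro k hk
    have hkK : (K : ℝ) ≤ k := by exact_mod_cast (Finset.mem_Ico.1 hk).1
    rw [h k]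
    have h1 : (y k / ((k : ℝ) + 1)) ^ 2 ≤ y k ^ 2 / ((K : ℝ) + 1) ^ 2 := by
      rw [div_pow]; gcongr
    have h2 : (y (k + 2) / ((k : ℝ) + 3)) ^ 2 ≤ y (k + 2) ^ 2 / ((K : ℝ) + 1) ^ 2 := by
      rw [div_pow]; gcongr; linarith
    have h3 : (y k ^ 2 + y (k + 2) ^ 2) / 2 / ((K : ℝ) + 1) ^ 2
        = (y k ^ 2 / ((K : ℝ) + 1) ^ 2 + y (k + 2) ^ 2 / ((K : ℝ) + 1) ^ 2) / 2 := by ring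
    rw [h3]
    nlinarith [sq_nonneg (y k / ((k : ℝ) + 1) + y (k + 2) / ((k : ℝ) + 3))]
  refine (Finset.sum_le_sum hb).trans ?_
  rw [← Finset.sum_div, ← Finset.sum_div, Finset.sum_add_distrib,
    Finset.sum_Ico_add' (fun k => y k ^ 2) K n 2]
  have h2 : ∑ k ∈ Finset.Ico (K + 2) (n + 2), y k ^ 2 ≤ Q :=
    (Finset.sum_le_sum_of_subset_of_nonneg (Finset.Ico_subset_Ico_left (by omega))
      fun _ _ _ => sq_nonneg _).trans (hy (n + 2))
  gcongr
  linarith [hy n]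

/-- Decay of the tails along a chain of successive antiderivatives. -/
theorem sum_sq_chain {G : ℕ → ℕ → ℝ} {M : ℕ} {Q : ℝ}
    (h : ∀ i < M, ∀ k, G (i + 1) (k + 1) = (G i k / (k + 1) - G i (k + 2) / (k + 3)) / 2)
    (h0 : ∀ n, ∑ k ∈ Finset.range n, G 0 k ^ 2 ≤ Q) (K : ℕ) :
    ∀ i ≤ M, ∀ n, ∑ k ∈ Finset.Ico (K + i) n, G i k ^ 2 ≤ Q / ((K : ℝ) + 1) ^ (2 * i) := by
  have hQ : 0 ≤ Q := by simpa using h0 0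
  intro i
  induction i with
  | zero =>
    intro _ n
    refine le_trans ?_ ((h0 n).trans (by simp))
    rw [Finset.range_eq_Ico]
    exact Finset.sum_le_sum_of_subset_of_nonneg (Finset.Ico_subset_Ico_left (by omega))
      fun _ _ _ => sq_nonneg _
  | succ i ih =>
    intro hi n
    refine (sum_sq_step (h i (by omega)) (ih (by omega)) n).trans ?_
    rw [div_div, mul_add, pow_add]
    have : (K : ℝ) + 1 ≤ ((K + i : ℕ) : ℝ) + 1 := by push_cast; linarith [Nat.cast_nonneg (α := ℝ) i]
    gcongr

/-- Endpoint values of the tails of a Chebyshev series, by summation by parts. -/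
theorem abs_sum_tail_le {a b : ℕ → ℝ} {ε A : ℝ} {K : ℕ} (hε : ε ^ 2 = 1)
    (hb : ∀ k, b (k + 1) = (a k - a (k + 2)) / 2) (ha : ∀ k ≥ K, |a k| ≤ A / ((k : ℝ) + 1))
    (r : ℕ) :
    |∑ i ∈ Finset.range r, ε ^ (K + i) * (b (K + i + 1) / ((K + i : ℕ) + 2))|
      ≤ 3 * A / ((K : ℝ) + 1) ^ 2 := by
  have hεa : |ε| = 1 := 
    (pow_eq_one_iff_of_nonneg (abs_nonneg ε) two_ne_zero).1 (by rw [sq_abs, hε])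
  have hA : 0 ≤ A := by
    have := (abs_nonneg _).trans (ha K le_rfl)
    have hK : (0 : ℝ) < (K : ℝ) + 1 := by positivity
    rwa [le_div_iff₀ hK, zero_mul] at this
  -- Each summand is `G k - G (k+2)` up to an error from the mismatch of `1/(k+2)` and `1/(k+4)`.
  -- That error is at most `H k - H (k+1)`, so both the main part and the error bound telescope.
  set G : ℕ → ℝ := fun k => ε ^ k * a k / (2 * ((k : ℝ) + 2)) with hG
  set H : ℕ → ℝ := fun k => A / (2 * ((k : ℝ) + 2) * ((k : ℝ) + 3)) with hH
  have key : ∀ r, |(∑ i ∈ Finset.range r, ε ^ (K + i) * (b (K + i + 1) / ((K + i : ℕ) + 2)))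
      - (G K + G (K + 1) - G (K + r) - G (K + r + 1))| ≤ H K - H (K + r) := by
    intro r
    induction r with
    | zero => simp
    | succ r ih =>
      rw [Finset.sum_range_succ]
      set k := K + r with hk
      have hstep : ε ^ k * (b (k + 1) / ((k : ℝ) + 2))
          = G k - G (k + 2) - ε ^ k * a (k + 2) / (((k : ℝ) + 2) * ((k : ℝ) + 4)) := by
        simp only [hG, hb]
        rw [pow_add ε k 2, hε]
        push_cast
        field_simp
        ring
      have hrem : |ε ^ k * a (k + 2) / (((k : ℝ) + 2) * ((k : ℝ) + 4))| ≤ H k - H (k + 1) := by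
        have h1 : H k - H (k + 1)
            = A / ((k : ℝ) + 3) / (((k : ℝ) + 2) * ((k : ℝ) + 4)) := by
          simp only [hH]; push_cast; field_simp; ring
        rw [h1, abs_div, abs_mul, abs_pow, hεa, one_pow, one_mul,
          abs_of_pos (show (0 : ℝ) < ((k : ℝ) + 2) * ((k : ℝ) + 4) by positivity)]
        have := ha (k + 2) (by omega)
        push_cast at this
        rw [show (k : ℝ) + 2 + 1 = k + 3 by ring] at this
        gcongr
      have e : K + (r + 1) = k + 1 := by omega
      rw [e, hstep]
      have t := abs_add_le ((∑ i ∈ Finset.range r,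
        ε ^ (K + i) * (b (K + i + 1) / ((K + i : ℕ) + 2)))
        - (G K + G (K + 1) - G k - G (k + 1)))
        (-(ε ^ k * a (k + 2) / (((k : ℝ) + 2) * ((k : ℝ) + 4))))
      rw [abs_neg] at t
      have e2 : ∀ S R : ℝ, S + (G k - G (k + 2) - R) - (G K + G (K + 1) - G (k + 1) - G (k + 1 + 1))
          = S - (G K + G (K + 1) - G k - G (k + 1)) + -R := by intros; ring
      rw [e2]
      linarith
  have hGb : ∀ k ≥ K, |G k| ≤ A / (2 * ((K : ℝ) + 1) ^ 2) := by
    intro k hk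
    have hkK : (K : ℝ) ≤ k := by exact_mod_cast hk
    simp only [hG]
    rw [abs_div, abs_mul, abs_pow, hεa, one_pow, one_mul,
      abs_of_pos (show (0 : ℝ) < 2 * ((k : ℝ) + 2) by positivity)]
    calc |a k| / (2 * ((k : ℝ) + 2)) ≤ A / ((k : ℝ) + 1) / (2 * ((k : ℝ) + 2)) := by
          gcongr; exact ha k hk
      _ = A / (2 * (((k : ℝ) + 1) * ((k : ℝ) + 2))) := by field_simp
      _ ≤ _ := by rw [sq]; gcongr; linarith
  have hHK : H K ≤ A / (2 * ((K : ℝ) + 1) ^ 2) := by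
    simp only [hH]
    rw [mul_assoc, sq]
    gcongr <;> linarith
  have hHn : 0 ≤ H (K + r) := by simp only [hH]; positivity
  have hk := abs_le.1 (key r)
  have g1 := abs_le.1 (hGb K le_rfl)
  have g2 := abs_le.1 (hGb (K + 1) (by omega))
  have g3 := abs_le.1 (hGb (K + r) (by omega))
  have g4 := abs_le.1 (hGb (K + r + 1) (by omega))
  -- Four boundary values of `G` and `H K` are each at most `A / (2 (K+1)²)`: five such terms, with
  -- room for six.
  have e3 : 3 * A / ((K : ℝ) + 1) ^ 2 = 6 * (A / (2 * ((K : ℝ) + 1) ^ 2)) := by field_simp; ring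
  have hpos : 0 ≤ A / (2 * ((K : ℝ) + 1) ^ 2) := by positivity
  rw [e3, abs_le]
  constructor <;> linarith [hk.1, hk.2, g1.1, g1.2, g2.1, g2.2, g3.1, g3.2, g4.1, g4.2]

theorem sum_inv_sq_le (n : ℕ) : ∑ k ∈ Finset.range n, 1 / ((k : ℝ) + 1) ^ 2 ≤ 2 := by
  have key : ∀ n : ℕ, ∑ k ∈ Finset.range (n + 1), 1 / ((k : ℝ) + 1) ^ 2 ≤ 2 - 1 / ((n : ℝ) + 1) := by
    intro n
    induction n with
    | zero => norm_num
    | succ n ih =>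
      rw [Finset.sum_range_succ]
      have : 1 / (((n + 1 : ℕ) : ℝ) + 1) ^ 2
          ≤ 1 / ((n : ℝ) + 1) - 1 / (((n + 1 : ℕ) : ℝ) + 1) := by
        push_cast
        rw [div_sub_div _ _ (by positivity) (by positivity),
          div_le_div_iff₀ (by positivity) (by positivity)]
        nlinarith [Nat.cast_nonneg (α := ℝ) n]
      linarith
  rcases n with _ | n
  · simp
  · have := key n
    have h2 : 0 ≤ 1 / ((n : ℝ) + 1) := by positivity
    linarith

/-! ### Primitives of the partial sums and their endpoint values. -/

/-- Termwise primitives of the partial sums `partialU`. -/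
noncomputable def primU (f : ℝ → ℝ) (n : ℕ) : ℝ[X] :=
  ∑ k ∈ Finset.range n, (coef f k / (k + 1)) • Chebyshev.T ℝ (k + 1)

theorem derivative_primU (f : ℝ → ℝ) (n : ℕ) : derivative (primU f n) = partialU f n := by
  rw [primU, partialU, derivative_sum]
  refine Finset.sum_congr rfl fun k _ => ?_
  rw [derivative_smul, Chebyshev.T_derivative_eq_U, add_sub_cancel_right]
  push_cast
  have e : ((k : ℝ[X]) + 1) * Chebyshev.U ℝ k = ((k : ℝ) + 1) • Chebyshev.U ℝ k := by
    rw [smul_eq_C_mul]; simp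
  rw [e, smul_smul, div_mul_cancel₀ _ (by positivity)]

theorem eval_one_primU (f : ℝ → ℝ) (n : ℕ) :
    (primU f n).eval 1 = ∑ k ∈ Finset.range n, 1 ^ k * (coef f k / (k + 1)) := by
  simp [primU, eval_finsetSum]

theorem eval_neg_one_primU (f : ℝ → ℝ) (n : ℕ) :
    (primU f n).eval (-1) = -∑ k ∈ Finset.range n, (-1) ^ k * (coef f k / (k + 1)) := by
  rw [primU, eval_finsetSum, ← Finset.sum_neg_distrib]
  refine Finset.sum_congr rfl fun k _ => ?_
  rw [eval_smul, Chebyshev.T_eval_neg_one, smul_eq_mul]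
  have : (((k : ℤ) + 1).negOnePow : ℤ) = (-1) ^ (k + 1) := by
    have := Int.negOnePow_def ((k : ℤ) + 1)
    rw [this]
    norm_cast
  rw [this]
  push_cast
  ring

theorem prim_eval_derivative (p : ℝ[X]) (x : ℝ) :
    prim (fun t => p.derivative.eval t) x = p.eval x - p.eval (-1) := by
  rw [prim, intervalIntegral.integral_eq_sub_of_hasDerivAt (fun t _ => p.hasDerivAt t)
    (p.derivative.continuous.intervalIntegrable _ _)]

theorem intervalIntegrable_of_mem {g : ℝ → ℝ} (hg : IntegrableOn g dom) {x : ℝ}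
    (hx : x ∈ Set.Icc (-1 : ℝ) 1) : IntervalIntegrable g volume (-1) x := by
  refine (integrableOn_dom_iff.1 hg).mono_set ?_
  rw [Set.uIcc_of_le hx.1, Set.uIcc_of_le (by norm_num)]
  exact Set.Icc_subset_Icc_right hx.2

theorem prim_sub {f g : ℝ → ℝ} (hf : IntegrableOn f dom) (hg : IntegrableOn g dom) {x : ℝ}
    (hx : x ∈ Set.Icc (-1 : ℝ) 1) : prim (fun t => f t - g t) x = prim f x - prim g x :=
  intervalIntegral.integral_sub (intervalIntegrable_of_mem hf hx) (intervalIntegrable_of_mem hg hx)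

theorem prim_eq_primU {f : ℝ → ℝ} (hf : L2dom f) (n : ℕ) {x : ℝ}
    (hx : x ∈ Set.Icc (-1 : ℝ) 1) :
    prim f x = prim (fun t => f t - (partialU f n).eval t) x
      + ((primU f n).eval x - (primU f n).eval (-1)) := by
  rw [prim_sub hf.integrableOn (memLp_eval _).integrableOn hx, ← derivative_primU,
    prim_eval_derivative]
  ring

/-- Since `1 ≤ 1/ω`, the plain `L²` norm is dominated by the norm with weight `1/ω`, in which the
`T_{k+1}` are orthogonal with square norm `π/2`. -/
theorem integral_sq_primU_le (f : ℝ → ℝ) (n : ℕ) :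
    ∫ x in dom, (primU f n).eval x ^ 2
      ≤ Real.pi / 2 * ∑ k ∈ Finset.range n, (coef f k / (k + 1)) ^ 2 := by
  have hc : ∀ p : ℝ[X], ContinuousOn (fun x => p.eval x) (Set.Icc (-1) 1) :=
    fun p => p.continuous.continuousOn
  have h1 : ∫ x in dom, (primU f n).eval x ^ 2
      ≤ ∫ x, (primU f n).eval x ^ 2 ∂Chebyshev.measureT := by
    rw [integral_measureT_eq_dom]
    refine setIntegral_mono_on (memLp_eval _).integrable_sq ?_ measurableSet_Ioo fun x hx => ?_
    · have := integrableOn_inv_weight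
      rw [integrableOn_dom_iff] at this ⊢
      exact this.continuousOn_mul ((primU f n).continuous.pow 2).continuousOn
    · exact le_mul_of_one_le_right (sq_nonneg _)
        ((one_le_inv₀ (weight_pos hx)).2 (weight_le_one x))
  refine h1.trans (le_of_eq ?_)
  have h2 : ∀ x : ℝ, (primU f n).eval x ^ 2 = ∑ j ∈ Finset.range n, ∑ k ∈ Finset.range n,
      coef f j / (j + 1) * (coef f k / (k + 1)) *
        ((Chebyshev.T ℝ ((j + 1 : ℕ) : ℤ)).eval x * (Chebyshev.T ℝ ((k + 1 : ℕ) : ℤ)).eval x) := by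
    intro x
    rw [sq, primU, eval_finsetSum, Finset.sum_mul_sum]
    refine Finset.sum_congr rfl fun j _ => Finset.sum_congr rfl fun k _ => ?_
    rw [eval_smul, eval_smul, smul_eq_mul, smul_eq_mul]
    push_cast
    ring
  have hi : ∀ j k : ℕ, Integrable (fun x => coef f j / (j + 1) * (coef f k / (k + 1)) *
        ((Chebyshev.T ℝ ((j + 1 : ℕ) : ℤ)).eval x * (Chebyshev.T ℝ ((k + 1 : ℕ) : ℤ)).eval x))
        Chebyshev.measureT := fun j k =>
    (Chebyshev.integrable_measureT ((hc _).mul (hc _))).const_mul _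
  simp_rw [h2]
  rw [integral_finsetSum _ fun j _ => integrable_finsetSum _ fun k _ => hi j k, Finset.mul_sum]
  refine Finset.sum_congr rfl fun j hj => ?_
  rw [integral_finsetSum _ fun k _ => hi j k, Finset.sum_eq_single j]
  · rw [integral_const_mul, Chebyshev.integral_T_real_mul_self_measureT_of_ne_zero (by omega)]
    ring
  · intro k _ hk
    rw [integral_const_mul,
      Chebyshev.integral_eval_T_real_mul_eval_T_real_measureT_of_ne (by omega), mul_zero]
  · intro h; exact absurd hj h

/-! ### Norm bounds for a function with prescribed low coefficients. -/

section Expansion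

variable {d : ℝ → ℝ} {N : ℕ} {l τ σ : ℝ}

/-- The zero mean equates the low part of the endpoint series, a multiple of `l`, with minus its
tails at `1` and `-1`, up to a remainder that tends to zero. -/
theorem abs_lead_le (hd : ContinuousOn d (Set.Icc (-1) 1)) (hN : 1 ≤ N)
    (hint : ∫ x in dom, d x = 0)
    (hlow : ∀ k < N, coef d k = l * (1 + (-1) ^ k) / (2 * ((k : ℝ) + 1)))
    (htail : ∀ ε : ℝ, ε ^ 2 = 1 → ∀ r,
      |∑ i ∈ Finset.range r, ε ^ (N + i) * (coef d (N + i) / ((N + i : ℕ) + 1))| ≤ τ) :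
    |l| ≤ τ := by
  have hd2 := memLp_of_continuousOn hd
  refine le_of_forall_pos_le_add fun δ hδ => ?_
  obtain ⟨n₀, hn₀⟩ := exists_wip_sub_partialU_le hd (ε := δ ^ 2 / 4) (by positivity)
  have hn := hn₀ (N + n₀) (by omega)
  set n := N + n₀ with hnN
  have h1 := prim_eq_primU hd2 n (x := 1) (by simp)
  rw [prim_one, hint, eval_one_primU, eval_neg_one_primU, hnN, Finset.sum_range_add,
    Finset.sum_range_add, ← hnN] at h1
  have hr := sq_prim_le (hd2.sub (memLp_eval (partialU d n))) (x := 1) (by simp)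
  change prim (fun t => d t - (partialU d n).eval t) 1 ^ 2 ≤ Real.pi *
    wip (fun t => d t - (partialU d n).eval t) (fun t => d t - (partialU d n).eval t) at hr
  have hr2 : prim (fun t => d t - (partialU d n).eval t) 1 ^ 2 ≤ δ ^ 2 := by
    have := Real.pi_pos
    nlinarith [Real.pi_le_four, wip_self_nonneg (fun t => d t - (partialU d n).eval t)]
  have hr3 := abs_le.1 (abs_le_of_sq_le_sq hr2 hδ.le)
  have t1 := abs_le.1 (htail 1 (by norm_num) n₀)
  have t2 := abs_le.1 (htail (-1) (by norm_num) n₀)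
  have hlowsum : ∑ k ∈ Finset.range N, 1 ^ k * (coef d k / ((k : ℝ) + 1))
      + ∑ k ∈ Finset.range N, (-1) ^ k * (coef d k / ((k : ℝ) + 1))
      = l * ∑ k ∈ Finset.range N, (1 + (-1) ^ k) ^ 2 / (2 * ((k : ℝ) + 1) ^ 2) := by
    rw [← Finset.sum_add_distrib, Finset.mul_sum]
    refine Finset.sum_congr rfl fun k hk => ?_
    rw [hlow k (Finset.mem_range.1 hk), one_pow]
    have : (k : ℝ) + 1 ≠ 0 := by positivity
    field_simp
  set s := ∑ k ∈ Finset.range N, (1 + (-1 : ℝ) ^ k) ^ 2 / (2 * ((k : ℝ) + 1) ^ 2) with hs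
  -- The term `k = 0` alone equals 2, which balances the two tails `2 τ`.
  have hs2 : 2 ≤ s := by
    have := Finset.single_le_sum (f := fun k : ℕ => (1 + (-1 : ℝ) ^ k) ^ 2 / (2 * ((k : ℝ) + 1) ^ 2))
      (fun k _ => by positivity) (Finset.mem_range.2 (show 0 < N by omega))
    norm_num at this
    exact this
  have habs : |l * s| ≤ 2 * τ + δ := by
    rw [← hlowsum, abs_le]
    constructor <;> linarith [t1.1, t1.2, t2.1, t2.2, hr3.1, hr3.2]
  rw [abs_mul, abs_of_nonneg (by linarith : 0 ≤ s)] at habs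
  nlinarith [abs_nonneg l]

theorem sum_coef_sq_low_le
    (hlow : ∀ k < N, coef d k = l * (1 + (-1) ^ k) / (2 * ((k : ℝ) + 1))) :
    ∑ k ∈ Finset.range N, coef d k ^ 2 ≤ 2 * l ^ 2 := by
  have : ∀ k ∈ Finset.range N, coef d k ^ 2 ≤ l ^ 2 * (1 / ((k : ℝ) + 1) ^ 2) := by
    intro k hk
    rw [hlow k (Finset.mem_range.1 hk)]
    have hk1 : (0 : ℝ) < (k : ℝ) + 1 := by positivity
    rcases neg_one_pow_eq_or ℝ k with h | h
    · rw [h]; apply le_of_eq; field_simp; ring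
    · rw [h]; simp; positivity
  refine (Finset.sum_le_sum this).trans ?_
  rw [← Finset.mul_sum]
  nlinarith [sum_inv_sq_le N, sq_nonneg l]

theorem abs_sum_low_le
    (hlow : ∀ k < N, coef d k = l * (1 + (-1) ^ k) / (2 * ((k : ℝ) + 1))) :
    |∑ k ∈ Finset.range N, (-1) ^ k * (coef d k / ((k : ℝ) + 1))| ≤ 2 * |l| := by
  have : ∀ k ∈ Finset.range N, |(-1) ^ k * (coef d k / ((k : ℝ) + 1))|
      ≤ |l| * (1 / ((k : ℝ) + 1) ^ 2) := by
    intro k hk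
    rw [hlow k (Finset.mem_range.1 hk)]
    have hk1 : (0 : ℝ) < (k : ℝ) + 1 := by positivity
    rcases neg_one_pow_eq_or ℝ k with h | h
    · rw [h]
      have e : 1 * (l * (1 + 1) / (2 * ((k : ℝ) + 1)) / ((k : ℝ) + 1))
          = l * (1 / ((k : ℝ) + 1) ^ 2) := by field_simp; ring
      rw [e, abs_mul, abs_of_pos (show (0 : ℝ) < 1 / ((k : ℝ) + 1) ^ 2 by positivity)]
    · rw [h]; simp; positivity
  refine (Finset.abs_sum_le_sum_abs _ _).trans ((Finset.sum_le_sum this).trans ?_)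
  rw [← Finset.mul_sum]
  nlinarith [sum_inv_sq_le N, abs_nonneg l]

/-- Parseval: low coefficients contribute at most `2 l²`, high ones `σ²`, and `π/2 ≤ 2`. -/
theorem wip_self_le_of_coef (hd : ContinuousOn d (Set.Icc (-1) 1))
    (hlow : ∀ k < N, coef d k = l * (1 + (-1) ^ k) / (2 * ((k : ℝ) + 1)))
    (hsq : ∀ r, ∑ i ∈ Finset.range r, coef d (N + i) ^ 2 ≤ σ ^ 2) :
    wip d d ≤ 4 * l ^ 2 + 2 * σ ^ 2 := by
  have hd2 := memLp_of_continuousOn hd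
  refine le_of_forall_pos_le_add fun δ hδ => ?_
  obtain ⟨n₀, hn₀⟩ := exists_wip_sub_partialU_le hd hδ
  have hn := hn₀ (N + n₀) (by omega)
  rw [wip_sub_partialU_self hd2, Finset.sum_range_add] at hn
  have h1 := sum_coef_sq_low_le hlow
  have h2 := hsq n₀
  nlinarith [Real.pi_le_four, Real.pi_pos, sq_nonneg l, sq_nonneg σ]

/-- The primitive is split into a remainder, `primU`, and the endpoint value of `primU`, the last at
most `3 τ`. With the factor 3 from squaring three terms and the length 2, `66 = 6·9 + 3·4` and `6 =
3·2`. -/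
theorem integral_sq_prim_le_of_coef (hd : ContinuousOn d (Set.Icc (-1) 1)) (hN : 1 ≤ N)
    (hl : |l| ≤ τ)
    (hlow : ∀ k < N, coef d k = l * (1 + (-1) ^ k) / (2 * ((k : ℝ) + 1)))
    (htail : ∀ r,
      |∑ i ∈ Finset.range r, (-1) ^ (N + i) * (coef d (N + i) / ((N + i : ℕ) + 1))| ≤ τ)
    (hsq : ∀ r, ∑ i ∈ Finset.range r, coef d (N + i) ^ 2 ≤ σ ^ 2) :
    ∫ x in dom, prim d x ^ 2 ≤ 66 * τ ^ 2 + 6 * (σ / N) ^ 2 := by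
  have hd2 := memLp_of_continuousOn hd
  have hN0 : (0 : ℝ) < N := by exact_mod_cast hN
  refine le_of_forall_pos_le_add fun δ hδ => ?_
  obtain ⟨n₀, hn₀⟩ := exists_wip_sub_partialU_le hd (ε := δ / 24) (by positivity)
  have hn := hn₀ (N + n₀) (by omega)
  set n := N + n₀ with hnN
  set R := fun t => d t - (partialU d n).eval t with hR
  have hE1 : |(primU d n).eval (-1)| ≤ 3 * τ := by
    rw [eval_neg_one_primU, hnN, Finset.sum_range_add, abs_neg]
    refine (abs_add_le _ _).trans ?_
    linarith [abs_sum_low_le hlow, htail n₀]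
  have hE1' : (primU d n).eval (-1) ^ 2 ≤ 9 * τ ^ 2 := by
    have := pow_le_pow_left₀ (abs_nonneg _) hE1 2
    rw [sq_abs] at this
    linarith [this, mul_pow 3 τ 2]
  have hpt : ∀ x ∈ dom, prim d x ^ 2
      ≤ 3 * (Real.pi * (δ / 24) + 9 * τ ^ 2) + 3 * (primU d n).eval x ^ 2 := by
    intro x hx
    have hx' := Set.Ioo_subset_Icc_self hx
    rw [prim_eq_primU hd2 n hx']
    have h1 : prim R x ^ 2 ≤ Real.pi * (δ / 24) :=
      (sq_prim_le (hd2.sub (memLp_eval _)) hx').trans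
        (mul_le_mul_of_nonneg_left hn Real.pi_pos.le)
    nlinarith [sq_nonneg (prim R x - (primU d n).eval x), sq_nonneg (prim R x + (primU d n).eval (-1)),
      sq_nonneg ((primU d n).eval x + (primU d n).eval (-1))]
  have hi := (memLp_eval (primU d n)).integrable_sq
  have hprim : L2dom (prim d) := memLp_of_continuousOn (continuousOn_prim hd2.integrableOn)
  have h1 := setIntegral_mono_on hprim.integrable_sq
    ((integrable_const (3 * (Real.pi * (δ / 24) + 9 * τ ^ 2))).add (hi.const_mul 3))
    measurableSet_Ioo hpt
  refine h1.trans ?_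
  simp only [Pi.add_apply]
  rw [integral_add (integrable_const _) (hi.const_mul 3)]
  have hvol : ∫ _ in dom, (3 * (Real.pi * (δ / 24) + 9 * τ ^ 2))
      = 6 * (Real.pi * (δ / 24) + 9 * τ ^ 2) := by simp [dom]; ring
  rw [hvol, integral_const_mul]
  have hE := integral_sq_primU_le d n
  rw [hnN, Finset.sum_range_add, ← hnN] at hE
  have hl2 : l ^ 2 ≤ τ ^ 2 := by
    rw [← sq_abs l]; exact pow_le_pow_left₀ (abs_nonneg _) hl 2
  have hlowsum : ∑ k ∈ Finset.range N, (coef d k / ((k : ℝ) + 1)) ^ 2 ≤ 2 * τ ^ 2 := by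
    refine le_trans (Finset.sum_le_sum (g := fun k => coef d k ^ 2) fun k _ => ?_)
      ((sum_coef_sq_low_le hlow).trans (by linarith))
    rw [div_pow]
    exact div_le_self (sq_nonneg _) (one_le_pow₀ (by linarith [Nat.cast_nonneg (α := ℝ) k]))
  have hhigh : ∑ i ∈ Finset.range n₀, (coef d (N + i) / (((N + i : ℕ) : ℝ) + 1)) ^ 2
      ≤ (σ / N) ^ 2 := by
    refine le_trans (Finset.sum_le_sum (g := fun i => coef d (N + i) ^ 2 / (N : ℝ) ^ 2)
      fun k _ => ?_) ?_
    · rw [div_pow]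
      gcongr
      push_cast
      linarith [Nat.cast_nonneg (α := ℝ) k]
    · rw [← Finset.sum_div, div_pow]
      gcongr
      exact hsq n₀
  have hpi := Real.pi_pos
  have hpi4 := Real.pi_le_four
  have hp2 : Real.pi / 2 ≤ 2 := by linarith
  have : Real.pi / 2 * (∑ k ∈ Finset.range N, (coef d k / ((k : ℝ) + 1)) ^ 2
      + ∑ i ∈ Finset.range n₀, (coef d (N + i) / (((N + i : ℕ) : ℝ) + 1)) ^ 2)
      ≤ 2 * (2 * τ ^ 2 + (σ / N) ^ 2) := by
    refine mul_le_mul hp2 (add_le_add hlowsum hhigh) ?_ (by norm_num)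
    exact add_nonneg (Finset.sum_nonneg fun _ _ => sq_nonneg _)
      (Finset.sum_nonneg fun _ _ => sq_nonneg _)
  have h5 : Real.pi * (δ / 24) ≤ 4 * (δ / 24) := by gcongr
  linarith

end Expansion

/-! ### Trial functions, Galerkin orthogonality and the error representation. -/

theorem HasWeakDeriv.sub {u v g h : ℝ → ℝ} (hu : HasWeakDeriv 1 u g)
    (hv : HasWeakDeriv 1 v h) :
    HasWeakDeriv 1 (fun x => u x - v x) (fun x => g x - h x) := by
  refine ⟨hu.1.sub hv.1, hu.2.1.sub hv.2.1, fun φ hφ hφc hφs => ?_⟩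
  have hφ1 : Continuous (deriv φ) := (contDiff_infty_iff_deriv.1 hφ).2.continuous
  have hs : tsupport (deriv φ) ⊆ dom := tsupport_deriv_subset.trans hφs
  have e1 := hu.2.2 φ hφ hφc hφs
  have e2 := hv.2.2 φ hφ hφc hφs
  rw [iteratedDeriv_one] at e1 e2 ⊢
  simp only [sub_mul]
  rw [integral_sub (integrableOn_mul_test hu.1 hφ1 hφc.deriv hs)
    (integrableOn_mul_test hv.1 hφ1 hφc.deriv hs),
    integral_sub (integrableOn_mul_test hu.2.1 hφ.continuous hφc hφs)
    (integrableOn_mul_test hv.2.1 hφ.continuous hφc hφs), e1, e2, mul_sub]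

theorem hasWeakDeriv_eval (p : ℝ[X]) :
    HasWeakDeriv 1 (fun x => p.eval x) (fun x => p.derivative.eval x) :=
  hasWeakDeriv_of_hasDerivAt p.continuous.continuousOn (fun x _ => p.hasDerivAt x)
    (memLp_eval _).integrableOn

theorem phi_eval_one (n : ℕ) : (phi n).eval 1 = 0 := by
  rw [phi, eval_sub, Chebyshev.T_eval_one, Chebyshev.T_eval_one, sub_self]

theorem phi_eval_neg_one (n : ℕ) : (phi n).eval (-1) = 0 := by
  rw [phi, eval_sub, Chebyshev.T_eval_neg_one, Chebyshev.T_eval_neg_one, Int.negOnePow_add,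
    Int.negOnePow_even 2 even_two, mul_one, sub_self]

theorem derivative_phi_zero : derivative (phi 0) = (2 : ℝ) • Chebyshev.U ℝ (1 : ℕ) := by
  rw [phi, derivative_sub, Chebyshev.T_derivative_eq_U, Chebyshev.T_derivative_eq_U, smul_eq_C_mul,
    map_ofNat]
  simp

theorem derivative_phi_succ (n : ℕ) : derivative (phi (n + 1))
    = ((n : ℝ) + 3) • Chebyshev.U ℝ (n + 2 : ℕ) - ((n : ℝ) + 1) • Chebyshev.U ℝ n := by
  rw [phi, derivative_sub, Chebyshev.T_derivative_eq_U, Chebyshev.T_derivative_eq_U,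
    smul_eq_C_mul, smul_eq_C_mul]
  have e1 : ((n + 1 : ℕ) : ℤ) + 2 - 1 = ((n + 2 : ℕ) : ℤ) := by push_cast; ring
  have e2 : ((n + 1 : ℕ) : ℤ) - 1 = (n : ℤ) := by push_cast; ring
  rw [e1, e2]
  push_cast
  simp only [map_add, map_natCast, map_ofNat, map_one]
  ring

theorem memV_phi (n : ℕ) : MemV (fun x => (phi n).eval x) := by
  refine ⟨memLp_eval _, ⟨_, hasWeakDeriv_eval _, ?_⟩, fun x => (phi n).eval x,
    (phi n).continuous.continuousOn, .rfl, phi_eval_neg_one n, phi_eval_one n⟩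
  exact integrableOn_of_continuousOn
    (continuous_weight.mul ((phi n).derivative.continuous.pow 2)).continuousOn

theorem trialSpace_spec {N : ℕ} {p : ℝ[X]} (hp : p ∈ trialSpace N) :
    p.eval 1 = 0 ∧ p.eval (-1) = 0 ∧ p.natDegree ≤ N := by
  induction hp using Submodule.span_induction with
  | mem x hx =>
    obtain ⟨n, hn, rfl⟩ := hx
    refine ⟨phi_eval_one n, phi_eval_neg_one n, ?_⟩
    refine (natDegree_sub_le _ _).trans ?_
    rw [Chebyshev.natDegree_T, Chebyshev.natDegree_T]
    omega
  | zero => simp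
  | add x y _ _ hx hy =>
    exact ⟨by rw [eval_add, hx.1, hy.1, add_zero], by rw [eval_add, hx.2.1, hy.2.1, add_zero],
      (natDegree_add_le _ _).trans (max_le hx.2.2 hy.2.2)⟩
  | smul a x _ hx =>
    exact ⟨by rw [eval_smul, hx.1, smul_zero], by rw [eval_smul, hx.2.1, smul_zero],
      (natDegree_smul_le _ _).trans hx.2.2⟩

theorem degree_derivative_lt_of_mem_trialSpace {N : ℕ} {p : ℝ[X]} (hN : 1 ≤ N)
    (hp : p ∈ trialSpace N) : p.derivative.degree < N := by
  refine degree_le_natDegree.trans_lt ?_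
  have h1 := natDegree_derivative_le p
  have h2 := (trialSpace_spec hp).2.2
  exact_mod_cast (show p.derivative.natDegree < N by omega)

/-- The discrete bilinear form is the weighted inner product of the derivatives. -/
theorem integral_deriv_weight_mul {p q : ℝ[X]} (hq1 : q.eval 1 = 0) (hq2 : q.eval (-1) = 0) :
    ∫ x in dom, -(deriv (fun y => weight y * p.eval y) x) * q.eval x
      = wip (fun x => p.eval x) (fun x => q.derivative.eval x) := by
  set F : ℝ → ℝ := fun x => weight x * p.eval x * q.eval x with hF
  set D : ℝ → ℝ := fun x => -x / weight x * p.eval x + weight x * p.derivative.eval x with hD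
  have hd : ∀ x ∈ dom, HasDerivAt (fun y => weight y * p.eval y) (D x) x := fun x hx =>
    (hasDerivAt_weight hx).mul (p.hasDerivAt x)
  have hDi : IntegrableOn (fun x => D x * q.eval x) dom := by
    -- The derivative of `ω` is singular at the endpoints, but only like `1/ω`, which is integrable.
    have h1 : IntegrableOn (fun x => (-x * p.eval x * q.eval x) * (weight x)⁻¹) dom := by
      have := integrableOn_inv_weight
      rw [integrableOn_dom_iff] at this ⊢
      refine this.continuousOn_mul (Continuous.continuousOn ?_)
      have := p.continuous; have := q.continuous
      fun_prop
    have h2 : IntegrableOn (fun x => weight x * p.derivative.eval x * q.eval x) dom :=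
      integrable_weight_mul_mul (memLp_eval _) (memLp_eval _)
    refine (h1.add h2).congr (.of_forall fun x => ?_)
    simp only [hD, Pi.add_apply]
    ring
  have hi2 : IntegrableOn (fun x => weight x * p.eval x * q.derivative.eval x) dom :=
    integrable_weight_mul_mul (memLp_eval _) (memLp_eval _)
  have h := eq_prim_of_hasDerivAt (F := F) (F' := fun x => D x * q.eval x
      + weight x * p.eval x * q.derivative.eval x) (x := 1)
    ((continuous_weight.mul p.continuous).mul q.continuous).continuousOn
    (fun x hx => (hd x hx).mul (q.hasDerivAt x)) (hDi.add hi2) (by simp)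
  rw [prim_one, integral_add hDi hi2] at h
  simp only [hF, hq1, hq2, mul_zero, zero_add] at h
  have h3 : ∫ x in dom, -(deriv (fun y => weight y * p.eval y) x) * q.eval x
      = ∫ x in dom, -(D x * q.eval x) :=
    setIntegral_congr_fun measurableSet_Ioo fun x hx => by
      simp only [(hd x hx).deriv]; ring
  rw [h3, integral_neg, wip]
  linarith

/-- Galerkin orthogonality. -/
theorem wip_sub_derivative_phi {f u g : ℝ → ℝ} {N : ℕ} {uN : ℝ[X]} (hu : IsWeakSolution f u)
    (hg : HasWeakDeriv 1 u g) (hg2 : L2dom g) (hN : IsDiscreteSolution f N uN) {k : ℕ}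
    (hk : k + 2 ≤ N) :
    wip (fun x => g x - uN.derivative.eval x) (fun x => (phi k).derivative.eval x) = 0 := by
  have h1 := (hu.2 _ (memV_phi k)).2
  have h2 := hN.2 k hk
  rw [integral_deriv_weight_mul (phi_eval_one k) (phi_eval_neg_one k), ← h1] at h2
  have h3 : energyForm u (fun x => (phi k).eval x)
      = wip g (fun x => (phi k).derivative.eval x) :=
    wip_congr (weakDeriv_ae_eq hg) (weakDeriv_ae_eq (hasWeakDeriv_eval _))
  rw [wip_sub_left hg2 (memLp_eval _) (memLp_eval _), h2, h3, sub_self]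

theorem prim_congr {f g : ℝ → ℝ} (h : f =ᵐ[volume.restrict dom] g) {x : ℝ}
    (hx : x ∈ Set.Icc (-1 : ℝ) 1) : prim f x = prim g x := by
  rw [prim, prim, intervalIntegral.integral_of_le hx.1, intervalIntegral.integral_of_le hx.1,
    integral_Ioc_eq_integral_Ioo, integral_Ioc_eq_integral_Ioo]
  exact integral_congr_ae (ae_restrict_of_ae_restrict_of_subset (Set.Ioo_subset_Ioo_right hx.2) h)

/-- A function with zero trace is the primitive of its weak derivative. -/
theorem ZeroTrace.ae_eq_prim {u g : ℝ → ℝ} (hz : ZeroTrace u) (hg : HasWeakDeriv 1 u g)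
    (hgi : IntegrableOn g dom) :
    u =ᵐ[volume.restrict dom] prim g ∧ ∫ x in dom, g x = 0 := by
  obtain ⟨w, hw, huw, hw1, hw2⟩ := hz
  obtain ⟨c, hc⟩ := hg.ae_eq_prim hgi
  have h1 : w =ᵐ[volume.restrict (Set.Icc (-1) 1)] fun x => c + prim g x := by
    rw [← Measure.restrict_congr_set (Ioo_ae_eq_Icc (a := (-1 : ℝ)) (b := 1) (μ := volume))]
    exact huw.symm.trans hc
  have h2 := Measure.eqOn_Icc_of_ae_eq volume (by norm_num) h1 hw
    (continuousOn_const.add (continuousOn_prim hgi))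
  have e1 := h2 (show (-1 : ℝ) ∈ Set.Icc (-1 : ℝ) 1 by simp)
  have e2 := h2 (show (1 : ℝ) ∈ Set.Icc (-1 : ℝ) 1 by simp)
  simp only [prim_neg_one, prim_one, hw1, hw2, add_zero] at e1 e2
  refine ⟨?_, by linarith⟩
  filter_upwards [hc] with x hx
  rw [hx, ← e1, zero_add]

/-- Representatives of the derivatives of a function in `H^m(I)`. -/
theorem MemH.exists_chain {m : ℕ} {u : ℝ → ℝ} (hu : MemH m u) :
    ∃ g : ℕ → ℝ → ℝ, (∀ k ≤ m, HasWeakDeriv k u (g k) ∧ L2dom (g k)) ∧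
      ∀ k < m, ∃ c : ℝ, g k =ᵐ[volume.restrict dom] fun x => c + prim (g (k + 1)) x := by
  choose! g hg using hu
  exact ⟨g, hg, fun k hk => HasWeakDeriv.ae_eq_prim
    ((hg k hk.le).1.of_succ (hg (k + 1) hk).1) (L2dom.integrableOn (hg (k + 1) hk).2)⟩

theorem integral_sq_le_normH {m k : ℕ} {u g : ℝ → ℝ} (hk : k ≤ m) (hg : HasWeakDeriv k u g) :
    ∫ x in dom, g x ^ 2 ≤ normH m u ^ 2 := by
  have h0 : ∀ k, 0 ≤ ∫ x in dom, (weakDeriv k u x) ^ 2 :=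
    fun k => integral_nonneg fun x => sq_nonneg _
  rw [normH, Real.sq_sqrt (Finset.sum_nonneg fun k _ => h0 k)]
  have h1 : ∫ x in dom, g x ^ 2 = ∫ x in dom, (weakDeriv k u x) ^ 2 :=
    integral_congr_ae ((weakDeriv_ae_eq hg).mono fun x hx => by simp only [hx])
  rw [h1]
  exact Finset.single_le_sum (f := fun k => ∫ x in dom, (weakDeriv k u x) ^ 2)
    (fun k _ => h0 k) (Finset.mem_range.2 (by omega))

/-- Testing with `φ_0` kills the coefficient of `U_1`; testing with `φ_{k+1}` gives `(k+3) d_{k+2} =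
(k+1) d_k`. The factor `(1 + (-1)^k)/2` selects even indices. -/
theorem coef_eq_of_orthogonal {d : ℝ → ℝ} {N : ℕ} (hd : L2dom d)
    (h : ∀ k, k + 2 ≤ N → wip d (fun x => (phi k).derivative.eval x) = 0) :
    ∀ k < N, coef d k = coef d 0 * (1 + (-1) ^ k) / (2 * ((k : ℝ) + 1)) := by
  have h' : ∀ k, k + 2 ≤ N → wipPoly d hd (phi k).derivative = 0 := h
  have hU : ∀ k : ℕ, wipPoly d hd (Chebyshev.U ℝ k) = Real.pi / 2 * coef d k :=
    fun k => wip_Ue_right d k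
  have hpi := Real.pi_ne_zero
  intro k
  induction k using Nat.twoStepInduction with
  | zero => intro _; norm_num
  | one =>
    intro hN
    have := h' 0 hN
    rw [derivative_phi_zero, map_smul, hU] at this
    simp [hpi] at this
    simp [this]
  | more k ih _ =>
    intro hN
    have h1 := h' (k + 1) (by omega)
    rw [derivative_phi_succ, map_sub, map_smul, map_smul, hU, hU, ih (by omega), smul_eq_mul,
      smul_eq_mul] at h1
    have hk1 : (k : ℝ) + 1 ≠ 0 := by positivity
    have hk3 : (k : ℝ) + 3 ≠ 0 := by positivity
    have hk3' : (k : ℝ) + 2 + 1 = k + 3 := by ring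
    push_cast
    rw [hk3', pow_add]
    have h2 : ((k : ℝ) + 3) * coef d (k + 2)
        - (k + 1) * (coef d 0 * (1 + (-1) ^ k) / (2 * ((k : ℝ) + 1))) = 0 := by
      refine (mul_eq_zero.1 (?_ : Real.pi / 2 * _ = 0)).resolve_left (by positivity)
      linear_combination h1
    field_simp at h2 ⊢
    linear_combination h2

/-- The error `u - u_N` in terms of a continuous representative of its derivative. -/
theorem error_repr {m N : ℕ} {f u : ℝ → ℝ} {uN : ℝ[X]} {g : ℕ → ℝ → ℝ} (hm : 2 ≤ m)
    (hg : ∀ k ≤ m, HasWeakDeriv k u (g k) ∧ L2dom (g k))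
    (hc : ∀ k < m, ∃ c : ℝ, g k =ᵐ[volume.restrict dom] fun x => c + prim (g (k + 1)) x)
    (hu : IsWeakSolution f u) (huN : IsDiscreteSolution f N uN) :
    ∃ d : ℝ → ℝ, ContinuousOn d (Set.Icc (-1) 1) ∧
      d =ᵐ[volume.restrict dom] (fun x => g 1 x - uN.derivative.eval x) ∧
      ∫ x in dom, d x = 0 ∧ normV (fun x => u x - uN.eval x) = Real.sqrt (wip d d) ∧
      normU (fun x => u x - uN.eval x) = Real.sqrt (∫ x in dom, prim d x ^ 2) := by
  obtain ⟨c, hc1⟩ := hc 1 (by omega)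
  obtain ⟨hg1, hg1'⟩ := hg 1 (by omega)
  have hg2 := (hg 2 hm).2
  have hae : (fun x => c + prim (g 2) x - uN.derivative.eval x)
      =ᵐ[volume.restrict dom] (fun x => g 1 x - uN.derivative.eval x) :=
    hc1.mono fun x hx => by simp only [hx]
  obtain ⟨hz1, hz2⟩ := hu.1.2.2.ae_eq_prim hg1 hg1'.integrableOn
  obtain ⟨hp1, hp2, -⟩ := trialSpace_spec huN.1
  have hp3 := prim_eval_derivative uN
  simp only [hp2, sub_zero] at hp3
  -- Two weak derivatives in `L²` make this representative continuous, as the convergence of the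
  -- partial sums requires.
  refine ⟨fun x => c + prim (g 2) x - uN.derivative.eval x, (continuousOn_const.add (continuousOn_prim hg2.integrableOn)).sub
    uN.derivative.continuous.continuousOn, hae, ?_, ?_, ?_⟩
  · rw [integral_congr_ae hae, integral_sub hg1'.integrableOn (memLp_eval _).integrableOn, hz2,
      ← prim_one, hp3, hp1, sub_zero]
  · rw [normV]
    congr 1
    refine integral_congr_ae ?_
    filter_upwards [weakDeriv_ae_eq (hg1.sub (hasWeakDeriv_eval uN)), hae] with x h1 h2
    rw [h1, h2]
    ring
  · rw [normU]
    congr 1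
    refine integral_congr_ae ?_
    filter_upwards [hz1, ae_restrict_mem (μ := volume) (s := dom) measurableSet_Ioo] with x h1 h2
    have hx := Set.Ioo_subset_Icc_self h2
    rw [h1, prim_congr hae hx, prim_sub hg1'.integrableOn (memLp_eval _).integrableOn hx, hp3]

/-- Stability of the discrete problem. -/
theorem wip_self_le_of_orthogonal {d g : ℝ → ℝ} {p : ℝ[X]} {N : ℕ} (hd : L2dom d)
    (hg : L2dom g) (hp : p ∈ trialSpace N)
    (hdg : d =ᵐ[volume.restrict dom] fun x => g x - p.derivative.eval x)
    (h : ∀ k, k + 2 ≤ N → wip d (fun x => (phi k).derivative.eval x) = 0) :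
    wip d d ≤ wip g g := by
  have h0 : wipPoly d hd p.derivative = 0 := by
    -- As `hdg` involves `p`, it travels with the induction: `g` is generalized so that it can
    -- absorb the rest of the polynomial.
    induction hp using Submodule.span_induction generalizing g with
    | mem x hx =>
      obtain ⟨n, hn, rfl⟩ := hx
      exact h n hn
    | zero => simp
    | add x y _ _ hx hy =>
      rw [derivative_add, map_add,
        hx (g := fun t => g t - y.derivative.eval t) (hg.sub (memLp_eval _))
          (hdg.trans (.of_forall fun t => by simp only [derivative_add, eval_add]; ring)),
        hy (g := fun t => g t - x.derivative.eval t) (hg.sub (memLp_eval _))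
          (hdg.trans (.of_forall fun t => by simp only [derivative_add, eval_add]; ring)),
        add_zero]
    | smul a x _ hx =>
      rw [derivative_smul, map_smul,
        hx (g := fun t => g t - (a - 1) * x.derivative.eval t)
          (hg.sub ((memLp_eval _).const_mul _))
          (hdg.trans (.of_forall fun t => by
            simp only [derivative_smul, eval_smul, smul_eq_mul]; ring)),
        smul_zero]
  rw [wipPoly_apply] at h0
  have h1 : wip d d = wip d g := by
    rw [wip_congr (.refl _ d) hdg, wip_sub_right hd hg (memLp_eval _), h0, sub_zero]
  have h2 := wip_self_nonneg (fun x => d x - g x)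
  have hdg2 : L2dom (fun x => d x - g x) := hd.sub hg
  rw [wip_sub_right hdg2 hd hg, wip_sub_left hd hg hd, wip_sub_left hd hg hg, wip_comm g d] at h2
  linarith

/-! ### The error bounds for large and small `N`. -/

/-- Coefficient bounds along the chain of derivatives of a function in `H^m(I)`. -/
theorem sum_coef_sq_chain_le {m N i : ℕ} {H : ℝ} {g : ℕ → ℝ → ℝ} (hN : 2 * m ≤ N)
    (hm : 1 ≤ m) (hg : ∀ k ≤ m, L2dom (g k))
    (hc : ∀ k < m, ∃ c : ℝ, g k =ᵐ[volume.restrict dom] fun x => c + prim (g (k + 1)) x)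
    (hH : ∫ x in dom, g m x ^ 2 ≤ H ^ 2) (hi : i ≤ m) (n : ℕ) :
    ∑ k ∈ Finset.Ico (N - m + i) n, coef (g (m - i)) k ^ 2 ≤ (H * (2 / N) ^ i) ^ 2 := by
  have hNpos : (0 : ℝ) < N := by exact_mod_cast (show 0 < N by omega)
  have h := sum_sq_chain (G := fun i k => coef (g (m - i)) k) (M := m) (Q := H ^ 2)
    (fun i hi k => by
      obtain ⟨c, hc⟩ := hc (m - (i + 1)) (by omega)
      rw [show m - (i + 1) + 1 = m - i by omega] at hc
      exact coef_succ_eq (hg _ (by omega)) hc k)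
    (fun n => by
      have h1 := sum_coef_sq_le (hg m le_rfl) n
      have h2 := wip_self_le (hg m le_rfl)
      have h3 : 0 ≤ ∑ k ∈ Finset.range n, coef (g m) k ^ 2 :=
        Finset.sum_nonneg fun _ _ => sq_nonneg _
      simp only [Nat.sub_zero]
      nlinarith [Real.pi_gt_three])
    (N - m) i hi n
  refine h.trans ?_
  -- The chain starts at `N - m` so that after `i ≤ m` shifts the tail still includes all indices
  -- from `N` on; `N ≥ 2m` keeps the start comparable with `N`.
  have hle : (N : ℝ) / 2 ≤ ((N - m : ℕ) : ℝ) + 1 := by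
    rw [Nat.cast_sub (by omega)]
    have : (2 : ℝ) * m ≤ N := by exact_mod_cast hN
    linarith
  have e : (H * (2 / (N : ℝ)) ^ i) ^ 2 = H ^ 2 / ((N : ℝ) / 2) ^ (2 * i) := by
    rw [mul_pow, ← pow_mul, mul_comm i 2, div_pow, div_pow]
    field_simp
  rw [e]
  gcongr

/-- The error bounds for large `N`. -/
theorem error_bounds_of_large {m N : ℕ} {H : ℝ} {g : ℕ → ℝ → ℝ} {d : ℝ → ℝ} {p : ℝ[X]}
    (hm : 2 ≤ m) (hN : 2 * m ≤ N) (hH0 : 0 ≤ H) (hg : ∀ k ≤ m, L2dom (g k))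
    (hc : ∀ k < m, ∃ c : ℝ, g k =ᵐ[volume.restrict dom] fun x => c + prim (g (k + 1)) x)
    (hH : ∫ x in dom, g m x ^ 2 ≤ H ^ 2) (hd : ContinuousOn d (Set.Icc (-1) 1))
    (hdg : d =ᵐ[volume.restrict dom] fun x => g 1 x - p.eval x) (hp : p.degree < N)
    (hint : ∫ x in dom, d x = 0)
    (horth : ∀ k, k + 2 ≤ N → wip d (fun x => (phi k).derivative.eval x) = 0) :
    wip d d ≤ (7 * (H * (2 / N) ^ m * N)) ^ 2 ∧
      ∫ x in dom, prim d x ^ 2 ≤ (25 * (H * (2 / N) ^ m)) ^ 2 := by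
  have hNpos : (0 : ℝ) < N := by exact_mod_cast (show 0 < N by omega)
  have hN1 : (1 : ℝ) ≤ N := by exact_mod_cast (show 1 ≤ N by omega)
  set ρ := H * (2 / (N : ℝ)) ^ m with hρ
  have hρ0 : 0 ≤ ρ := by positivity
  have hd2 := memLp_of_continuousOn hd
  have hlow := coef_eq_of_orthogonal hd2 horth
  have hhigh : ∀ i, coef d (N + i) = coef (g 1) (N + i) := fun i => by
    rw [coef_congr hdg, coef_sub (hg 1 (by omega)) (memLp_eval p),
      coef_eval_eq_zero hp (by omega), sub_zero]
  have hsq : ∀ r, ∑ i ∈ Finset.range r, coef d (N + i) ^ 2 ≤ (ρ * N) ^ 2 := by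
    intro r
    have h := sum_coef_sq_chain_le hN (by omega) hg hc hH (i := m - 1) (by omega) (N + r)
    rw [show N - m + (m - 1) = N - 1 by omega, show m - (m - 1) = 1 by omega] at h
    have h2 : ∑ i ∈ Finset.range r, coef d (N + i) ^ 2
        = ∑ k ∈ Finset.Ico N (N + r), coef (g 1) k ^ 2 := by
      rw [Finset.sum_Ico_eq_sum_range, show N + r - N = r by omega]
      exact Finset.sum_congr rfl fun i _ => by rw [hhigh]
    rw [h2]
    refine (Finset.sum_le_sum_of_subset_of_nonneg (Finset.Ico_subset_Ico_left (by omega))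
      fun _ _ _ => sq_nonneg _).trans (h.trans ?_)
    have e : ρ * N = 2 * (H * (2 / (N : ℝ)) ^ (m - 1)) := by
      rw [hρ]
      obtain ⟨m', rfl⟩ : ∃ m', m = m' + 1 := ⟨m - 1, by omega⟩
      rw [pow_succ, Nat.add_sub_cancel]
      field_simp
    rw [e]
    have : 0 ≤ H * (2 / (N : ℝ)) ^ (m - 1) := by positivity
    exact pow_le_pow_left₀ this (by linarith) 2
  have htail : ∀ ε : ℝ, ε ^ 2 = 1 → ∀ r,
      |∑ i ∈ Finset.range r, ε ^ (N + i) * (coef d (N + i) / ((N + i : ℕ) + 1))| ≤ 3 * ρ := by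
    intro ε hε r
    obtain ⟨K, rfl⟩ : ∃ K, N = K + 1 := ⟨N - 1, by omega⟩
    have hεa : |ε| = 1 := (pow_eq_one_iff_of_nonneg (abs_nonneg ε) two_ne_zero).1
      (by rw [sq_abs, hε])
    -- A pointwise bound for the coefficients of `u''`, each being dominated by its tail sum of
    -- squares. Two further powers of `1/N` come from `abs_sum_tail_le`.
    set A := H * (2 / ((K + 1 : ℕ) : ℝ)) ^ (m - 2) with hA
    have hA0 : 0 ≤ A := by positivity
    have h := abs_sum_tail_le (a := fun k => coef (g 2) k / ((k : ℝ) + 1)) (b := coef (g 1))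
      (ε := ε) (A := A) (K := K) hε (fun k => by
        obtain ⟨c, hc⟩ := hc 1 (by omega)
        rw [coef_succ_eq (hg 2 hm) hc k]
        push_cast
        rw [show (k : ℝ) + 2 + 1 = k + 3 by ring]) (fun k hk => by
        have h := sum_coef_sq_chain_le hN (by omega) hg hc hH (i := m - 2) (by omega) (k + 1)
        rw [show m - (m - 2) = 2 by omega] at h
        have h1 := (Finset.single_le_sum (f := fun k => coef (g 2) k ^ 2)
          (fun _ _ => sq_nonneg _) (Finset.mem_Ico.2 ⟨by omega, k.lt_succ_self⟩)).trans h
        have h2 := abs_le_of_sq_le_sq h1 hA0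
        rw [abs_div, abs_of_pos (show (0 : ℝ) < (k : ℝ) + 1 by positivity)]
        gcongr) r
    have e1 : ∑ i ∈ Finset.range r, ε ^ (K + 1 + i) *
        (coef d (K + 1 + i) / ((K + 1 + i : ℕ) + 1))
        = ε * ∑ i ∈ Finset.range r, ε ^ (K + i) * (coef (g 1) (K + i + 1) / ((K + i : ℕ) + 2)) := by
      rw [Finset.mul_sum]
      refine Finset.sum_congr rfl fun i _ => ?_
      rw [hhigh, show K + 1 + i = K + i + 1 by omega, pow_succ]
      push_cast
      ring
    rw [e1, abs_mul, hεa, one_mul]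
    refine h.trans ?_
    have e2 : ρ = 4 * (A / ((K : ℝ) + 1) ^ 2) := by
      rw [hρ, hA]
      obtain ⟨m', rfl⟩ : ∃ m', m = m' + 2 := ⟨m - 2, by omega⟩
      rw [pow_add, Nat.add_sub_cancel]
      push_cast
      rw [div_pow _ _ 2]
      ring
    have : 0 ≤ A / ((K : ℝ) + 1) ^ 2 := by positivity
    rw [e2, mul_div_assoc]
    linarith
  have hl := abs_lead_le hd (by omega) hint hlow htail
  have h1 := wip_self_le_of_coef hd hlow hsq
  have h2 := integral_sq_prim_le_of_coef hd (by omega) hl hlow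
    (htail (-1) (by norm_num)) hsq
  rw [mul_div_assoc, div_self hNpos.ne', mul_one] at h2
  have hl2 : coef d 0 ^ 2 ≤ 9 * ρ ^ 2 := by
    have := pow_le_pow_left₀ (abs_nonneg _) hl 2
    rw [sq_abs] at this
    linarith [mul_pow 3 ρ 2]
  have hρN : ρ ^ 2 ≤ (ρ * N) ^ 2 := by
    gcongr
    exact le_mul_of_one_le_right hρ0 hN1
  -- With `τ = 3ρ` and `σ = ρN`: `4·9 + 2 = 38 ≤ 7²`, and `66·9 + 6 = 600 ≤ 25²`.
  constructor
  · nlinarith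
  · nlinarith

/-- The error bounds for all `N`, by stability. -/
theorem error_bounds_of_stability {d g : ℝ → ℝ} {H : ℝ} (hd : ContinuousOn d (Set.Icc (-1) 1))
    (hg : L2dom g) (hstab : wip d d ≤ wip g g) (hH : ∫ x in dom, g x ^ 2 ≤ H ^ 2) :
    wip d d ≤ H ^ 2 ∧ ∫ x in dom, prim d x ^ 2 ≤ (3 * H) ^ 2 := by
  have hd2 := memLp_of_continuousOn hd
  have h1 : wip d d ≤ H ^ 2 := hstab.trans ((wip_self_le hg).trans hH)
  have hprim : L2dom (prim d) := memLp_of_continuousOn (continuousOn_prim hd2.integrableOn)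
  refine ⟨h1, ?_⟩
  have h2 := setIntegral_mono_on hprim.integrable_sq
    (integrable_const (Real.pi * wip d d)) measurableSet_Ioo
    (fun x hx => sq_prim_le hd2 (Set.Ioo_subset_Icc_self hx))
  refine h2.trans ?_
  have : ∫ _ in dom, Real.pi * wip d d = 2 * (Real.pi * wip d d) := by
    rw [setIntegral_const]; simp [dom]; norm_num
  rw [this]
  nlinarith [Real.pi_le_four, Real.pi_pos, wip_self_nonneg d]

end ChebyshevDegenerate

open ChebyshevDegenerate
theorem mainTheorem1 (m : ℕ) (hm : 2 ≤ m) :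
    ∃ C : ℝ, 0 < C ∧
      ∀ (f u : ℝ → ℝ), MemH m u → IsWeakSolution f u →
        ∀ (N : ℕ) (uN : ℝ[X]), 1 ≤ N → IsDiscreteSolution f N uN →
          normV (fun x => u x - uN.eval x) ≤ C * (N : ℝ) ^ (1 - (m : ℤ)) * normH m u ∧
          normU (fun x => u x - uN.eval x) ≤ C * (N : ℝ) ^ (-(m : ℤ)) * normH m u := by
  have hm0 : (0 : ℝ) < m := by exact_mod_cast (show 0 < m by omega)
  -- The first summand serves `N ≥ 2m`. The second serves `N < 2m`, where `N^m ≤ (2m)^m` lets a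
  -- bound without decay suffice.
  refine ⟨25 * 2 ^ m + 3 * (2 * m) ^ m, by positivity, fun f u hu hw N uN hN huN => ?_⟩
  obtain ⟨g, hg, hc⟩ := hu.exists_chain
  obtain ⟨d, hd, hdg, hint, hV, hU⟩ := error_repr hm hg hc hw huN
  have hg1 := hg 1 (by omega)
  have horth : ∀ k, k + 2 ≤ N → wip d (fun x => (phi k).derivative.eval x) = 0 := fun k hk => by
    rw [wip_congr hdg .rfl]
    exact wip_sub_derivative_phi hw hg1.1 hg1.2 huN hk
  have hH0 : 0 ≤ normH m u := Real.sqrt_nonneg _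
  set H := normH m u with hH
  have hNpos : (0 : ℝ) < N := by exact_mod_cast (show 0 < N by omega)
  have hN1 : (1 : ℝ) ≤ N := by exact_mod_cast hN
  have eV : (N : ℝ) ^ (1 - (m : ℤ)) = N / (N : ℝ) ^ m := by
    rw [zpow_sub₀ hNpos.ne', zpow_one, zpow_natCast]
  have eU : (N : ℝ) ^ (-(m : ℤ)) = 1 / (N : ℝ) ^ m := by
    rw [zpow_neg, zpow_natCast, one_div]
  rw [hV, hU, eV, eU]
  have hNm : 0 < (N : ℝ) ^ m := by positivity
  have p2 : (0 : ℝ) < 2 ^ m := by positivity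
  have pm : (0 : ℝ) < (2 * m : ℝ) ^ m := by positivity
  rcases le_or_gt (2 * m) N with hlarge | hsmall
  · obtain ⟨h1, h2⟩ := error_bounds_of_large hm hlarge hH0 (fun k hk => (hg k hk).2) hc
      (integral_sq_le_normH le_rfl (hg m le_rfl).1) hd hdg
      (degree_derivative_lt_of_mem_trialSpace hN huN.1) hint horth
    constructor
    · refine (Real.sqrt_le_sqrt h1).trans ?_
      rw [Real.sqrt_sq (by positivity), div_pow]
      have e : 7 * (H * (2 ^ m / (N : ℝ) ^ m) * N) = 7 * 2 ^ m * (N / (N : ℝ) ^ m) * H := by ring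
      rw [e]
      gcongr
      linarith
    · refine (Real.sqrt_le_sqrt h2).trans ?_
      rw [Real.sqrt_sq (by positivity), div_pow]
      have e : 25 * (H * (2 ^ m / (N : ℝ) ^ m)) = 25 * 2 ^ m * (1 / (N : ℝ) ^ m) * H := by ring
      rw [e]
      gcongr
      linarith
  · obtain ⟨h1, h2⟩ := error_bounds_of_stability hd hg1.2
      (wip_self_le_of_orthogonal (memLp_of_continuousOn hd) hg1.2 huN.1 hdg horth)
      (integral_sq_le_normH (m := m) (by omega) hg1.1)
    rw [← hH] at h1 h2
    have hNle : (N : ℝ) ^ m ≤ (2 * m : ℝ) ^ m := by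
      gcongr
      exact_mod_cast hsmall.le
    have hone : 1 ≤ (2 * m : ℝ) ^ m * (1 / (N : ℝ) ^ m) := by
      rw [mul_one_div, one_le_div hNm]
      exact hNle
    have key : 3 * H ≤ (25 * 2 ^ m + 3 * (2 * m : ℝ) ^ m) * (1 / (N : ℝ) ^ m) * H := by
      gcongr
      have : 0 ≤ 25 * 2 ^ m * (1 / (N : ℝ) ^ m) := by positivity
      linarith
    constructor
    · refine (Real.sqrt_le_sqrt h1).trans ?_
      rw [Real.sqrt_sq hH0]
      refine (by linarith : H ≤ 3 * H).trans (key.trans ?_)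
      gcongr
    · refine (Real.sqrt_le_sqrt h2).trans ?_
      rw [Real.sqrt_sq (by positivity)]
      exact key
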